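/- **Setting.** Let $\mathcal M$ be a finite set of $M\ge 2$ freeway subnetworks (agents) and $E\subseteq\mathcal M\times\mathcal M$ a directed graph, $(i,j)\in E$ meaning that traffic flows from $i$ to $j$. Call $i\ne j$ neighbours, $j\in N_i$, if $(i,j)\in E$, or $(j,i)\in E$, or $(i,m),(j,m)\in E$ for some $m$; assume that the neighbour graph is connected. Let $N$ be the horizon. For $0\le k\le N$ the state of $i$ is $x_i(k)=(\rho_i(k),q_i(k))$ (density, on-ramp queue), and for $0\le k<N$ its input is $u_i(k)=(r_i(k),\phi_i(k))$ (ramp flow, mainline flow). Each agent has local variables $\hat u_i=(u_i,\bar u_i)$, its own inputs and copies of those of its neighbours; $E_i$ is the selection matrix with $E_i\mathbf u=(u_j)_{j\in\{i\}\cup N_i}$. *Problem P1.* Given initial states $x_i(0)$, matrices $B_{ij}(k)$, demands $\psi_i(k)\in\mathbb R^2$, off-ramp ratios $\beta_i(k)$, bounds $V^{\max},C^{\max},\phi_i^{\max},\rho_i^{\max}$, a wave speed $\omega$, weights $h_i\in\mathbb R^{2}$ and a capacity $\bar\delta$, minimize $\sum_i J_i(x_i,E_i\mathbf u)$ subject to,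 for all $i$ and $0\le k<N$, $$x_i(k+1)=x_i(k)+B_{ii}(k)u_i(k)+\sum_{j\neq i:(j,i)\in E}B_{ij}(k)u_j(k)+\psi_i(k),$$ $$\phi_i(k)\le\min\{\rho_i(k)V^{\max},\phi_i^{\max}\},\qquad r_i(k)\le\min\{q_i(k),C^{\max}\},$$ $$\phi_i(k)(1-\beta_i(k))+r_i(k)\le\min\{\phi_j^{\max},\ \omega(\rho_j^{\max}-\rho_j(k))\}\quad\text{for all }j\text{ with }(i,j)\in E,$$ $$\sum_{i}h_i^\top u_i(k)\le\bar\delta .$$ Here each $J_i$ is a real-valued convex function of all of $(x_i,\hat u_i)$, for instance the travel time $\sum_{k<N}\Delta t\,(q_i(k)+L_i\rho_i(k))$. Let $\mathcal U_i$ be the set of $(x_i,\hat u_i)$ that satisfy the dynamics of $i$ and the constraints in lines two and three for $i$, the densities $\rho_j$ of downstream $j$ being computed by their dynamics from the copies in $\hat u_i$. Put $(H_i\hat u_i)(k)=h_i^\top u_i(k)$ and $\delta=(\bar\delta,\dots,\bar\delta)\in\mathbb R^N$. *Inner iteration (dual-consensus ADMM), penalties $\rho_1,\rho_2>0$, given $\mathbf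 u,\theta$.* Start with any $\lambda_i^0\in\mathbb R^N$ and any $\alpha^0_{ij}\in\mathbb R^N$ ($j\in N_i$) with $\alpha^0_{ij}=-\alpha^0_{ji}$. With $p_i^l=2\sum_{j\in N_i}\alpha_{ij}^l-\rho_2\sum_{j\in N_i}(\lambda_i^l+\lambda_j^l)$, let $(x_i^{l+1},\hat u_i^{l+1},y_i^{l+1})$ minimize, over $(x_i,\hat u_i)\in\mathcal U_i$ and $y_i\ge0$, $$J_i(x_i,\hat u_i)+\frac1{4|N_i|\rho_2}\Big\|H_i\hat u_i-\frac{\delta}{M}-p_i^l+y_i\Big\|_2^2+\frac{\rho_1}2\Big\|\hat u_i-E_i\mathbf u+\frac1{\rho_1}\theta_i\Big\|_2^2,$$ and put $\lambda_i^{l+1}=\frac1{2|N_i|\rho_2}\big(H_i\hat u_i^{l+1}-\frac{\delta}{M}-p_i^l+y_i^{l+1}\big)$, $\alpha_{ij}^{l+1}=\alpha_{ij}^l+\frac{\rho_2}2(\lambda_i^{l+1}-\lambda_j^{l+1})$. *Outer iteration (distributed double-consensus ADMM).* Start with any $\mathbf u^0,\theta^0$. At step $n$ run the inner iteration with $\mathbf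 u=\mathbf u^n,\theta=\theta^n$, let $(x_i^{n+1},\hat u_i^{n+1})$ be the limit of its iterates as $l\to\infty$, and put $$\mathbf u^{n+1}=\Big(\sum_iE_i^\top E_i\Big)^{-1}\sum_iE_i^\top\Big(\hat u_i^{n+1}+\frac1{\rho_1}\theta_i^n\Big),\qquad \theta_i^{n+1}=\theta_i^n+\rho_1(\hat u_i^{n+1}-E_i\mathbf u^{n+1}).$$ **Theorem 1.** Suppose that P1 has an optimal solution. Then the limits defining $(x_i^{n+1},\hat u_i^{n+1})$ exist for every run of the algorithm, every $n$ and every $i$, and: (i) there is an optimal solution $(\mathbf u^*,x^*)$ of P1 such that, with $\hat u_i^*=E_i\mathbf u^*$, $\hat u_i^n\to\hat u_i^*$ and $x_i^n\to x_i^*$ as $n\to\infty$ for all $i$; (ii) for every optimal solution $(\mathbf u^*,x^*)$ of P1, with $\hat u_i^*=E_i\mathbf u^*$, $\Big|\sum_i\big(J_i(x_i^n,\hat u_i^n)-J_i(x_i^*,\hat u_i^*)\big)\Big|\to0$ as $n\to\infty$. -/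

import Mathlib

open Filter Topology

noncomputable section

namespace Traffic

/-- A state trajectory `x(0), …, x(N)` of one subnetwork; `x(k) = (ρ(k), q(k))`, that is,
coordinate `0` is the density and coordinate `1` the on-ramp queue length. -/
abbrev States (N : ℕ) : Type := Fin (N + 1) → Fin 2 → ℝ

/-- An input trajectory `u(0), …, u(N-1)` of one subnetwork; `u(k) = (r(k), φ(k))`, that is,
coordinate `0` is the on-ramp flow and coordinate `1` the mainline flow. -/
abbrev Inputs (N : ℕ) : Type := Fin N → Fin 2 → ℝ

/-- The neighbour graph of a road network in which `E.Adj i j` means that traffic flows from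
`i` to `j`: two subnetworks are neighbours if traffic flows from one to the other or if both
feed the same subnetwork, which is the case in which the inputs of one of them enter the local
constraints of the other. On a corridor the neighbours of `i` are `i - 1` and `i + 1`. -/
def nbrGraph {V : Type*} (E : Digraph V) : SimpleGraph V where
  Adj i j := i ≠ j ∧ (E.Adj i j ∨ E.Adj j i ∨ ∃ m, E.Adj i m ∧ E.Adj j m)
  symm := ⟨fun i j h => ⟨h.1.symm, by
    rcases h.2 with h | h | ⟨m, h₁, h₂⟩
    · exact Or.inr (Or.inl h)
    · exact Or.inl h
    · exact Or.inr (Or.inr ⟨m, h₂, h₁⟩)⟩⟩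
  loopless := ⟨fun i h => h.1 rfl⟩

open Classical in
/-- `N_i`, the neighbours of agent `i`. -/
def nbrs {V : Type*} [Fintype V] (E : Digraph V) (i : V) : Finset V :=
  Finset.univ.filter fun j => (nbrGraph E).Adj i j

open Classical in
/-- `{i} ∪ N_i`: the agents whose inputs are represented at agent `i`. -/
def hood {V : Type*} [Fintype V] (E : Digraph V) (i : V) : Finset V :=
  Finset.univ.filter fun j => j = i ∨ (nbrGraph E).Adj i j

theorem self_mem_hood {V : Type*} [Fintype V] (E : Digraph V) (i : V) : i ∈ hood E i := by
  simp [hood]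

/-- The local decision variables `û_i`: the own inputs of agent `i` and its copies of the
inputs of its neighbours. -/
abbrev Copies {V : Type*} [Fintype V] (E : Digraph V) (N : ℕ) (i : V) : Type _ :=
  ↥(hood E i) → Inputs N

/-- Own component `u_i` of `û_i`. -/
def own {V : Type*} [Fintype V] {E : Digraph V} {N : ℕ} {i : V} (w : Copies E N i) : Inputs N :=
  w ⟨i, self_mem_hood E i⟩

/-- The selection matrix `E_i`, applied to the net variable: `(E_i u)_j = u_j`. -/
def select {V : Type*} [Fintype V] (E : Digraph V) {N : ℕ} (i : V) (u : V → Inputs N) :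
    Copies E N i :=
  fun j => u j

open Classical in
/-- The transpose `E_iᵀ` of the selection matrix: extension by zero. -/
def unselect {V : Type*} [Fintype V] {E : Digraph V} {N : ℕ} {i : V} (w : Copies E N i) :
    V → Inputs N :=
  fun j => if h : j ∈ hood E i then w ⟨j, h⟩ else 0

/-- Squared Euclidean norm on the space of local decision variables. -/
def sqNorm {V : Type*} [Fintype V] {E : Digraph V} {N : ℕ} {i : V} (w : Copies E N i) : ℝ :=
  ∑ j, ∑ k, ∑ c, (w j k c) ^ 2

/-- The data of the relaxed finite-horizon traffic optimization problem on a network of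
subnetworks `V` with horizon `N`. -/
structure Problem (V : Type*) [Fintype V] (N : ℕ) where
  /-- The road graph: `E.Adj i j` if traffic flows from `i` to `j`. -/
  E : Digraph V
  /-- The input matrices of the dynamics. In the cell transmission model with step `Δt` they are
  `B i i k = !![Δt / L i, -Δt / L i; -Δt, 0]` and
  `B i j k = !![0, Δt / L i * (1 - β j k); 0, 0]` for `j` upstream of `i`. -/
  B : V → V → Fin N → Matrix (Fin 2) (Fin 2) ℝ
  /-- Uncontrollable external demand. -/
  ψ : V → Fin N → Fin 2 → ℝ
  /-- Initial state. -/
  x₀ : V → Fin 2 → ℝ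
  /-- Off-ramp splitting ratios. -/
  β : V → Fin N → ℝ
  /-- Upper bound of the speed. -/
  Vmax : ℝ
  /-- Upper bound of the ramp metering rate. -/
  Cmax : ℝ
  /-- Congestion wave speed. -/
  ω : ℝ
  /-- Maximal flows. -/
  φmax : V → ℝ
  /-- Maximal densities. -/
  ρmax : V → ℝ
  /-- Weights `h_i` of the capacity constraint. -/
  h : V → Fin 2 → ℝ
  /-- Capacity of the controlled area. -/
  δ : ℝ
  /-- The local objectives `J_i(x_i, û_i)`. -/
  J : (i : V) → States N × Copies E N i → ℝ

namespace Problem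

variable {V : Type*} [Fintype V] {N : ℕ} (P : Problem V N)

open Classical in
/-- `x` is the state trajectory of subnetwork `i` under the inputs `u`:
`x_i(0)` is given and
`x_i(k+1) = x_i(k) + B_{ii} u_i(k) + ∑_{j upstream of i} B_{ij} u_j(k) + ψ_i(k)`. -/
def Evolves (i : V) (u : V → Inputs N) (x : States N) : Prop :=
  x 0 = P.x₀ i ∧
  ∀ k : Fin N, x k.succ = x k.castSucc + (P.B i i k).mulVec (u i k)
    + ∑ j ∈ Finset.univ.filter (fun j => j ≠ i ∧ P.E.Adj j i), (P.B i j k).mulVec (u j k)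
    + P.ψ i k

/-- The relaxed flow constraints of subnetwork `i`, for all steps `k`. -/
def FlowConstraints (i : V) (u : V → Inputs N) (x : V → States N) : Prop :=
  ∀ k : Fin N,
    u i k 1 ≤ min (x i k.castSucc 0 * P.Vmax) (P.φmax i) ∧
    (∀ j, P.E.Adj i j →
      u i k 1 * (1 - P.β i k) + u i k 0 ≤
        min (P.φmax j) (P.ω * (P.ρmax j - x j k.castSucc 0))) ∧
    u i k 0 ≤ min (x i k.castSucc 1) P.Cmax

/-- Feasibility for the centralized problem. -/
def Feasible (u : V → Inputs N) (x : V → States N) : Prop :=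
  (∀ i, P.Evolves i u (x i)) ∧
  (∀ i, P.FlowConstraints i u x) ∧
  ∀ k : Fin N, ∑ i, P.h i ⬝ᵥ u i k ≤ P.δ

/-- The total objective `∑ J_i(x_i, û_i)`. -/
def totalCost (x : V → States N) (w : (i : V) → Copies P.E N i) : ℝ :=
  ∑ i, P.J i (x i, w i)

/-- `(u, x)` is an optimal solution of the centralized problem; agent `i`'s optimal decision
variable is then `û_i = E_i u`. -/
def IsOptimal (u : V → Inputs N) (x : V → States N) : Prop :=
  P.Feasible u x ∧ ∀ u' x', P.Feasible u' x' →
    P.totalCost x (fun i => select P.E i u) ≤ P.totalCost x' (fun i => select P.E i u')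

/-- The local feasible set `𝒰_i` of agent `i`, in the variables `(x_i, û_i)`: the own dynamics
and the flow constraints of `i` hold, where the density of a downstream subnetwork `j` is the one
that its dynamics yield for the copies of agent `i`. -/
def localSet (i : V) : Set (States N × Copies P.E N i) :=
  {v | ∃ z : V → States N, z i = v.1 ∧
    (∀ j, j = i ∨ P.E.Adj i j → P.Evolves j (unselect v.2) (z j)) ∧
    P.FlowConstraints i (unselect v.2) z}

/-- `p_i = 2 ∑_{j ∈ N_i} α_{ij} - ρ₂ ∑_{j ∈ N_i} (λ_i + λ_j)`. -/
def price (ρ₂ : ℝ) (lam : V → Fin N → ℝ) (α : V → V → Fin N → ℝ) (i : V) : Fin N → ℝ :=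
  fun k => 2 * ∑ j ∈ nbrs P.E i, α i j k - ρ₂ * ∑ j ∈ nbrs P.E i, (lam i k + lam j k)

/-- `H_i û_i - δ_t / M - p_i + y_i`. -/
def gap (p : Fin N → ℝ) {i : V} (w : Copies P.E N i) (y : Fin N → ℝ) : Fin N → ℝ :=
  fun k => P.h i ⬝ᵥ own w k - P.δ / Fintype.card V - p k + y k

/-- The objective of the local minimization, in the variables `(x_i, û_i, y_i)`. -/
def localCost (ρ₁ ρ₂ : ℝ) (u : V → Inputs N) {i : V} (θ : Copies P.E N i) (p : Fin N → ℝ)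
    (v : (States N × Copies P.E N i) × (Fin N → ℝ)) : ℝ :=
  P.J i v.1
    + 1 / (4 * (nbrs P.E i).card * ρ₂) * ∑ k, (P.gap p v.1.2 v.2 k) ^ 2
    + ρ₁ / 2 * sqNorm (v.1.2 - select P.E i u + (1 / ρ₁) • θ)

/-- An infinite run of dual-consensus ADMM for the net variable `u` and the multipliers `θ`.
`lam 0`, `α 0` are the initial values; `(x l, w l, y l)` with `l ≥ 1` are the iterates
`(x_i^l, û_i^l, y_i^l)`, while `x 0, w 0, y 0` play no role. -/
structure IsInnerRun (ρ₁ ρ₂ : ℝ) (u : V → Inputs N) (θ : (i : V) → Copies P.E N i)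
    (x : ℕ → V → States N) (w : ℕ → (i : V) → Copies P.E N i) (y lam : ℕ → V → Fin N → ℝ)
    (α : ℕ → V → V → Fin N → ℝ) : Prop where
  init : ∀ i j, (nbrGraph P.E).Adj i j → α 0 i j = -α 0 j i
  mem : ∀ l i, (x (l + 1) i, w (l + 1) i) ∈ P.localSet i ∧ 0 ≤ y (l + 1) i
  min : ∀ l i, IsMinOn (P.localCost ρ₁ ρ₂ u (θ i) (P.price ρ₂ (lam l) (α l) i))
    {v | v.1 ∈ P.localSet i ∧ 0 ≤ v.2} ((x (l + 1) i, w (l + 1) i), y (l + 1) i)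
  lam_step : ∀ l i, lam (l + 1) i = (1 / (2 * (nbrs P.E i).card * ρ₂)) •
    P.gap (P.price ρ₂ (lam l) (α l) i) (w (l + 1) i) (y (l + 1) i)
  α_step : ∀ l i j, (nbrGraph P.E).Adj i j →
    α (l + 1) i j = α l i j + (ρ₂ / 2) • (lam (l + 1) i - lam (l + 1) j)

/-- A run of distributed double-consensus ADMM. At outer step `n` the inner iterates are
`xin n l`, `win n l`, `yin n l`, `lam n l`, `α n l`, with inner counter `l`; the outer iterates
are `x n`, `w n` (the `û_i^n`), the net variable `u n` and the multipliers `θ n`. -/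
structure Run (ρ₁ ρ₂ : ℝ) where
  x : ℕ → V → States N
  w : ℕ → (i : V) → Copies P.E N i
  u : ℕ → V → Inputs N
  θ : ℕ → (i : V) → Copies P.E N i
  xin : ℕ → ℕ → V → States N
  win : ℕ → ℕ → (i : V) → Copies P.E N i
  yin : ℕ → ℕ → V → Fin N → ℝ
  lam : ℕ → ℕ → V → Fin N → ℝ
  α : ℕ → ℕ → V → V → Fin N → ℝ
  inner : ∀ n, P.IsInnerRun ρ₁ ρ₂ (u n) (θ n) (xin n) (win n) (yin n) (lam n) (α n)
  /-- The values returned by the inner iteration are its limits. -/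
  x_step : ∀ n i, x (n + 1) i = limUnder atTop (fun l => xin n l i)
  w_step : ∀ n i, w (n + 1) i = limUnder atTop (fun l => win n l i)
  /-- `u^{n+1} = (∑ E_iᵀ E_i)⁻¹ ∑ E_iᵀ (û_i^{n+1} + θ_i^n / ρ₁)`; the matrix `∑ E_iᵀ E_i` is
  diagonal, and its entry at `j` is the number of agents that hold `u_j` or a copy of it. -/
  u_step : ∀ n j, u (n + 1) j =
    (1 / ((hood P.E j).card : ℝ)) • ∑ i, unselect (w (n + 1) i + (1 / ρ₁) • θ n i) j
  θ_step : ∀ n i, θ (n + 1) i = θ n i + ρ₁ • (w (n + 1) i - select P.E i (u (n + 1)))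

end Problem

end Traffic

end

/-!
Eliminating the states (they are affine functions of the inputs) leaves a convex problem in the
decision variables `w = (û_i)_i`: minimize `netCost w` over the polyhedron `admissible` (local
constraints and capacity), subject to consensus, `w = (E_i u)_i` for some `u`. Since all constraints
are affine and the costs are finite everywhere, Lagrange multipliers exist without a Slater
condition (`exists_multipliers`): a Hahn-Banach separation puts an affine function between the
optimal value and the cost, and Farkas' lemma represents it by the constraints. All else follows
from two Lyapunov functions.

*Inner iteration.* The penalized problem over `admissible` has a minimizer `w*`
(`exists_proximal_point`) with prices `μ ≥ 0` of the capacity constraint (`exists_price`). Sharing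
the slack of that constraint equally, the imbalances `H_i w*_i - δ/M + y*_i` sum to zero, so on the
connected neighbour graph they are the divergence of an antisymmetric edge flow `2 g`
(`exists_flow`). With `m_i = λ_i - μ` and `a_ij = α_ij - g_ij`, the optimality conditions at `w*` and
at the iterates give
`ρ₁ ‖w^{l+1} - w*‖² ≤ Φ_l - Φ_{l+1}`, `Φ = ∑_i ∑_{j ∈ N_i} (‖a_ij‖² / ρ₂ + ρ₂ / 4 ‖m_i + m_j‖²)`
(`dualLyapunov_sub_le`), so `w^l → w*` (`inner_tendsto`), whatever the prices do.

*Outer iteration.* By the first part, the outer iteration is exact two-block ADMM. With a saddle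
point `(w*, θ*)`, where `θ*` is orthogonal to the consensus subspace (`exists_consensus_saddle`),
`‖θ - θ*‖² / ρ₁ + ρ₁ ‖E u - w*‖²` decreases by at least the same expression in the increments
(`admm_descent`). Hence the increments tend to zero, a cluster point exists and is again a saddle
point, and the Lyapunov function of that saddle point tends to zero along a subsequence, hence
altogether (`consensus_admm_tendsto`). The costs converge because finite convex functions are
continuous.
-/

noncomputable section

namespace Traffic

/-! ### Farkas' lemma and Lagrange multipliers for affine constraints -/

/-- **Farkas' lemma**, by the induction of Bartl: if the induction hypothesis does not apply to
the constraints in `s` alone, there is a point `e` at which they hold and the new constraint is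
positive, and everything is projected along `e` onto the kernel of the new constraint. -/
theorem farkas {X ι : Type*} [AddCommGroup X] [Module ℝ X] (s : Finset ι) :
    ∀ (a : ι → X →ₗ[ℝ] ℝ) (c : X →ₗ[ℝ] ℝ), (∀ x, (∀ i ∈ s, a i x ≤ 0) → c x ≤ 0) →
      ∃ μ : ι → ℝ, (∀ i, 0 ≤ μ i) ∧ ∀ x, c x = ∑ i ∈ s, μ i * a i x := by
  classical
  induction s using Finset.induction_on with
  | empty =>
    intro a c h
    refine ⟨0, fun _ => le_rfl, fun x => ?_⟩
    have h1 := h x (by simp)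
    have h2 := h (-x) (by simp)
    rw [map_neg] at h2
    simp only [Finset.sum_empty]
    linarith
  | insert j s hj ih =>
    intro a c h
    by_cases hs : ∀ x, (∀ i ∈ s, a i x ≤ 0) → c x ≤ 0
    · obtain ⟨μ, hμ, hc⟩ := ih a c hs
      refine ⟨Function.update μ j 0, fun i => ?_, fun x => ?_⟩
      · rcases eq_or_ne i j with rfl | hij
        · simp
        · simp [hij, hμ i]
      · rw [Finset.sum_insert hj, hc x, Function.update_self, zero_mul, zero_add]
        refine Finset.sum_congr rfl fun i hi => ?_
        rw [Function.update_of_ne (by rintro rfl; exact hj hi)]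
    · push Not at hs
      obtain ⟨e₀, he₀, hce₀⟩ := hs
      have hpos : 0 < a j e₀ := by
        by_contra hle
        refine absurd (h e₀ fun i hi => ?_) (not_le.2 hce₀)
        rcases Finset.mem_insert.1 hi with rfl | hi
        · exact not_lt.1 hle
        · exact he₀ i hi
      set e : X := (a j e₀)⁻¹ • e₀ with he_def
      have hje : a j e = 1 := by
        rw [he_def, map_smul, smul_eq_mul, inv_mul_cancel₀ hpos.ne']
      have hse : ∀ i ∈ s, a i e ≤ 0 := fun i hi => by
        rw [he_def, map_smul, smul_eq_mul]
        exact mul_nonpos_of_nonneg_of_nonpos (inv_pos.2 hpos).le (he₀ i hi)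
      have hce : 0 ≤ c e := by
        rw [he_def, map_smul, smul_eq_mul]
        exact (mul_pos (inv_pos.2 hpos) hce₀).le
      obtain ⟨μ, hμ, hc⟩ := ih (fun i => a i - a i e • a j) (c - c e • a j) (fun x hx => by
        have := h (x - a j x • e) (fun i hi => by
          rcases Finset.mem_insert.1 hi with rfl | hi
          · simp [hje]
          · have := hx i hi
            simp only [LinearMap.sub_apply, LinearMap.smul_apply, smul_eq_mul] at this
            simp only [map_sub, map_smul, smul_eq_mul]
            linarith)
        simp only [map_sub, map_smul, smul_eq_mul] at this
        simp only [LinearMap.sub_apply, LinearMap.smul_apply, smul_eq_mul]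
        linarith)
      refine ⟨Function.update μ j (c e - ∑ i ∈ s, μ i * a i e), fun i => ?_, fun x => ?_⟩
      · rcases eq_or_ne i j with rfl | hij
        · rw [Function.update_self]
          have : ∑ k ∈ s, μ k * a k e ≤ 0 :=
            Finset.sum_nonpos fun k hk => mul_nonpos_of_nonneg_of_nonpos (hμ k) (hse k hk)
          linarith
        · simp [hij, hμ i]
      · have h1 := hc x
        simp only [LinearMap.sub_apply, LinearMap.smul_apply, smul_eq_mul, mul_sub,
          Finset.sum_sub_distrib] at h1
        rw [Finset.sum_insert hj, Function.update_self, sub_mul, Finset.sum_mul]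
        have h2 : ∑ i ∈ s, Function.update μ j (c e - ∑ i ∈ s, μ i * a i e) i * a i x
            = ∑ i ∈ s, μ i * a i x := Finset.sum_congr rfl fun i hi => by
          rw [Function.update_of_ne (by rintro rfl; exact hj hi)]
        have h3 : ∑ i ∈ s, μ i * a i e * a j x = ∑ i ∈ s, μ i * (a i e * a j x) :=
          Finset.sum_congr rfl fun i _ => mul_assoc _ _ _
        rw [h2, h3]
        linarith

/-- Farkas' lemma for affine functions: homogenize, with the coordinate of `ℝ` required to be
nonnegative. The case of homogenizing coordinate `0` is that of a recession direction. -/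
theorem affine_farkas {X ι : Type*} [AddCommGroup X] [Module ℝ X] (s : Finset ι)
    (g : ι → X →ᵃ[ℝ] ℝ) (l : X →ᵃ[ℝ] ℝ) {x₀ : X} (hx₀ : ∀ i ∈ s, g i x₀ ≤ 0)
    (h : ∀ x, (∀ i ∈ s, g i x ≤ 0) → 0 ≤ l x) :
    ∃ μ : ι → ℝ, (∀ i, 0 ≤ μ i) ∧ ∀ x, 0 ≤ l x + ∑ i ∈ s, μ i * g i x := by
  classical
  have hdec : ∀ (f : X →ᵃ[ℝ] ℝ) x, f x = f.linear x + f 0 := fun f x =>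
    congrFun (AffineMap.decomp f) x
  let hom : (X →ᵃ[ℝ] ℝ) → (X × ℝ →ₗ[ℝ] ℝ) := fun f => f.linear.coprod (f 0 • LinearMap.id)
  have hhom : ∀ f x t, hom f (x, t) = f.linear x + f 0 * t := fun f x t => by simp [hom]
  obtain ⟨μ, hμ, hc⟩ := farkas (insert none (s.image some))
    (fun o : Option ι => o.elim (-LinearMap.snd ℝ X ℝ) fun i => hom (g i)) (-hom l) (by
      rintro ⟨x, t⟩ hx
      have ht : 0 ≤ t := by simpa using hx none (by simp)
      have hg : ∀ i ∈ s, (g i).linear x + g i 0 * t ≤ 0 := fun i hi => by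
        have := hx (some i) (by simp [hi])
        simpa [hhom] using this
      rw [LinearMap.neg_apply, hhom, neg_nonpos]
      rcases ht.eq_or_lt with rfl | ht
      · -- `x` is a recession direction, so `l` is nonnegative on the ray from `x₀` along `x`.
        have hray : ∀ r : ℝ, 0 ≤ r → 0 ≤ l x₀ + r * l.linear x := fun r hr => by
          have h1 := h (x₀ + r • x) (fun i hi => by
            have h2 := hg i hi
            have h3 := hx₀ i hi
            rw [hdec] at h3 ⊢
            rw [map_add, map_smul, smul_eq_mul]
            have := mul_nonpos_of_nonneg_of_nonpos hr (by simpa using h2)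
            linarith)
          rw [hdec] at h1 ⊢
          rw [map_add, map_smul, smul_eq_mul] at h1
          linarith
        by_contra hneg
        have hneg : l.linear x < 0 := by simpa using hneg
        have h0 := hray 0 le_rfl
        have h1 := hray ((l x₀ + 1) / -l.linear x) (div_nonneg (by linarith) (by linarith))
        have h2 : (l x₀ + 1) / -l.linear x * l.linear x = -(l x₀ + 1) := by
          rw [div_neg, neg_mul, div_mul_cancel₀ _ hneg.ne]
        linarith
      · have h1 := h (t⁻¹ • x) (fun i hi => by
          have h2 := hg i hi
          rw [hdec, map_smul, smul_eq_mul]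
          have h3 : t⁻¹ * (g i).linear x + g i 0 = t⁻¹ * ((g i).linear x + g i 0 * t) := by
            field_simp
          rw [h3]
          exact mul_nonpos_of_nonneg_of_nonpos (inv_pos.2 ht).le h2)
        rw [hdec, map_smul, smul_eq_mul] at h1
        have h3 : l.linear x + l 0 * t = t * (t⁻¹ * l.linear x + l 0) := by
          field_simp
        rw [h3]
        exact mul_nonneg ht.le h1)
  refine ⟨fun i => μ (some i), fun i => hμ _, fun x => ?_⟩
  have h1 := hc (x, 1)
  rw [Finset.sum_insert (by simp), Finset.sum_image (by simp)] at h1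
  simp only [LinearMap.neg_apply, hhom, Option.elim, LinearMap.snd_apply, mul_one] at h1
  simp only [← hdec] at h1
  have := hμ none
  linarith

/-- A polyhedron: the solution set of finitely many affine inequalities. -/
def IsPolyhedron {X : Type*} [AddCommGroup X] [Module ℝ X] (S : Set X) : Prop :=
  ∃ T : Finset (X →ᵃ[ℝ] ℝ), S = {x | ∀ g ∈ T, g x ≤ 0}

section Polyhedron

variable {X : Type*} [AddCommGroup X] [Module ℝ X]

theorem IsPolyhedron.setOf_nonpos (g : X →ᵃ[ℝ] ℝ) : IsPolyhedron {x | g x ≤ 0} :=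
  ⟨{g}, by simp⟩

theorem IsPolyhedron.setOf_le (f g : X →ᵃ[ℝ] ℝ) : IsPolyhedron {x | f x ≤ g x} := by
  have h := IsPolyhedron.setOf_nonpos (f - g)
  simpa only [AffineMap.coe_sub, Pi.sub_apply, sub_nonpos] using h

theorem IsPolyhedron.iInter {ι : Type*} [Finite ι] {S : ι → Set X}
    (h : ∀ i, IsPolyhedron (S i)) : IsPolyhedron (⋂ i, S i) := by
  classical
  have := Fintype.ofFinite ι
  choose T hT using h
  refine ⟨Finset.univ.biUnion T, Set.ext fun x => ?_⟩
  simp only [hT, Set.mem_iInter, Set.mem_ofPred_eq, Finset.mem_biUnion, Finset.mem_univ, true_and]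
  exact ⟨fun h g ⟨i, hi⟩ => h i g hi, fun h i g hi => h g ⟨i, hi⟩⟩

theorem IsPolyhedron.inter {S T : Set X} (hS : IsPolyhedron S) (hT : IsPolyhedron T) :
    IsPolyhedron (S ∩ T) := by
  rw [Set.inter_eq_iInter]
  exact IsPolyhedron.iInter fun b => by cases b <;> assumption

theorem IsPolyhedron.preimage {Y : Type*} [AddCommGroup Y] [Module ℝ Y] {S : Set Y}
    (hS : IsPolyhedron S) (f : X →ₗ[ℝ] Y) : IsPolyhedron (f ⁻¹' S) := by
  classical
  obtain ⟨T, rfl⟩ := hS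
  refine ⟨T.image fun g => g.comp f.toAffineMap, Set.ext fun x => ?_⟩
  simp

theorem IsPolyhedron.convex {S : Set X} (hS : IsPolyhedron S) : Convex ℝ S := by
  obtain ⟨T, rfl⟩ := hS
  have : {x : X | ∀ g ∈ T, g x ≤ 0} = ⋂ g ∈ T, g ⁻¹' Set.Iic 0 := by ext; simp
  rw [this]
  exact convex_iInter₂ fun g _ => (convex_Iic 0).affine_preimage g

end Polyhedron

/-- The variational inequality that holds at a minimizer of the sum of a convex function `F` and
a function `q` with the first-order expansion `D` in the direction of `z`. -/
theorem variational_inequality {Y : Type*} [AddCommGroup Y] [Module ℝ Y] {K : Set Y}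
    {F q : Y → ℝ} (hF : ConvexOn ℝ K F) {v z : Y} (hv : v ∈ K) (hz : z ∈ K)
    (hmin : ∀ x ∈ K, F v + q v ≤ F x + q x) {D C : ℝ}
    (hq : ∀ t : ℝ, q (v + t • (z - v)) ≤ q v + t * D + t ^ 2 * C) : 0 ≤ F z - F v + D := by
  have key : ∀ t ∈ Set.Ioc (0 : ℝ) 1, 0 ≤ F z - F v + D + t * C := fun t ht => by
    have hx : (1 - t) • v + t • z = v + t • (z - v) := by
      rw [sub_smul, one_smul, smul_sub]
      abel
    have h1 := hF.2 hv hz (by linarith [ht.2] : (0 : ℝ) ≤ 1 - t) ht.1.le (by ring)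
    have h2 := hmin _ (hF.1 hv hz (by linarith [ht.2] : (0 : ℝ) ≤ 1 - t) ht.1.le (by ring))
    rw [hx] at h1 h2
    simp only [smul_eq_mul] at h1
    have h3 := hq t
    have h4 : 0 ≤ t * (F z - F v + D + t * C) := by nlinarith
    exact nonneg_of_mul_nonneg_right h4 ht.1
  refine ge_of_tendsto (x := 𝓝[>] (0 : ℝ)) (f := fun t => F z - F v + D + t * C) ?_ ?_
  · have h : Tendsto (fun t : ℝ => F z - F v + D + t * C) (𝓝 0) (𝓝 (F z - F v + D + 0 * C)) :=
      (continuous_const.add (continuous_id.mul continuous_const)).tendsto 0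
    rw [zero_mul, add_zero] at h
    exact h.mono_left nhdsWithin_le_nhds
  · exact eventually_of_mem (Ioc_mem_nhdsGT one_pos) key

section Multipliers

variable {X : Type*} [NormedAddCommGroup X] [NormedSpace ℝ X] [FiniteDimensional ℝ X]

theorem IsPolyhedron.isClosed {S : Set X} (hS : IsPolyhedron S) : IsClosed S := by
  obtain ⟨T, rfl⟩ := hS
  have : {x : X | ∀ g ∈ T, g x ≤ 0} = ⋂ g ∈ T, g ⁻¹' Set.Iic 0 := by ext; simp
  rw [this]
  exact isClosed_biInter fun g _ => isClosed_Iic.preimage g.continuous_of_finiteDimensional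

theorem continuous_of_convexOn {f : X → ℝ} (hf : ConvexOn ℝ Set.univ f) : Continuous f :=
  continuousOn_univ.1 (hf.continuousOn isOpen_univ)

/-- An affine function fits between a convex function `f` and a lower bound `m` of `f` on a
convex set: separate the open strict epigraph of `f` from `S × {m}`. -/
theorem exists_affine_between {f : X → ℝ} (hf : ConvexOn ℝ Set.univ f) {S : Set X}
    (hS : Convex ℝ S) (hne : S.Nonempty) {m : ℝ} (hm : ∀ x ∈ S, m ≤ f x) :
    ∃ l : X →ᵃ[ℝ] ℝ, (∀ x, l x ≤ f x) ∧ ∀ x ∈ S, m ≤ l x := by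
  have hcont := continuous_of_convexOn hf
  obtain ⟨F, u, hA, hB⟩ := geometric_hahn_banach_open
    (s := {p : X × ℝ | p.1 ∈ Set.univ ∧ f p.1 < p.2}) (t := S ×ˢ {m}) hf.convex_strict_epigraph
    (by simpa using isOpen_lt (hcont.comp continuous_fst) continuous_snd)
    (hS.prod (convex_singleton m))
    (Set.disjoint_left.2 fun p hp hq => by
      have h1 := hm _ hq.1
      have h2 : p.2 = m := hq.2
      have h3 := hp.2
      linarith)
  have hF : ∀ x t, F (x, t) = F (x, 0) + t * F (0, 1) := fun x t => by
    rw [← smul_eq_mul, ← map_smul, ← map_add]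
    simp
  obtain ⟨x₀, hx₀⟩ := hne
  have hτ : F (0, 1) < 0 := by
    have h1 := hA (x₀, f x₀ + 1) ⟨trivial, by simp⟩
    have h2 := hB (x₀, m) ⟨hx₀, rfl⟩
    rw [hF] at h1 h2
    have h3 := hm x₀ hx₀
    by_contra hle
    have := mul_nonneg (by linarith : 0 ≤ f x₀ + 1 - m) (not_lt.1 hle)
    linarith
  set τ := F (0, 1) with hτ_def
  have hl : ∀ x, τ⁻¹ * (u - F (x, 0)) = -τ⁻¹ * F (x, 0) + u / τ := fun x => by
    rw [div_eq_mul_inv]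
    ring
  have hτi : τ⁻¹ ≤ 0 := (inv_lt_zero.2 hτ).le
  -- The separating hyperplane is the graph of `x ↦ (u - F (x, 0)) / τ`.
  refine ⟨(-τ⁻¹) • ((F : X × ℝ →ₗ[ℝ] ℝ).comp (LinearMap.inl ℝ X ℝ)).toAffineMap
    + AffineMap.const ℝ X (u / τ), fun x => ?_, fun x hx => ?_⟩
  · have h1 : F (x, 0) + f x * τ ≤ u := by
      by_contra hlt
      have hlt := not_le.1 hlt
      have h := hA (x, f x + (F (x, 0) + f x * τ - u) / -τ)
        ⟨trivial, lt_add_of_pos_right _ (div_pos (by linarith) (by linarith))⟩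
      rw [hF, add_mul, div_neg, neg_mul, div_mul_cancel₀ _ hτ.ne] at h
      linarith
    have h2 : τ⁻¹ * (u - F (x, 0)) ≤ f x := by
      have := mul_le_mul_of_nonpos_left (by linarith : f x * τ ≤ u - F (x, 0)) hτi
      rwa [mul_left_comm, inv_mul_cancel₀ hτ.ne, mul_one] at this
    rw [hl] at h2
    simpa using h2
  · have h := hB (x, m) ⟨hx, rfl⟩
    rw [hF] at h
    have h2 : m ≤ τ⁻¹ * (u - F (x, 0)) := by
      have := mul_le_mul_of_nonpos_left (by linarith : u - F (x, 0) ≤ m * τ) hτi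
      rwa [mul_left_comm, inv_mul_cancel₀ hτ.ne, mul_one] at this
    rw [hl] at h2
    simpa using h2

/-- Lagrange multipliers exist for the affine constraints `g t ≤ 0` of a convex minimization
problem over a polyhedron `S`; since every constraint is affine, no Slater condition is needed. -/
theorem exists_multipliers {f : X → ℝ} (hf : ConvexOn ℝ Set.univ f) {S : Set X}
    (hS : IsPolyhedron S) {κ : Type*} [Fintype κ] (g : κ → X →ᵃ[ℝ] ℝ) {x₀ : X} (hx₀ : x₀ ∈ S)
    (hg : ∀ t, g t x₀ ≤ 0) (hmin : ∀ x ∈ S, (∀ t, g t x ≤ 0) → f x₀ ≤ f x) :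
    ∃ μ : κ → ℝ, (∀ t, 0 ≤ μ t) ∧ ∀ x ∈ S, f x₀ ≤ f x + ∑ t, μ t * g t x := by
  have hSg : IsPolyhedron (S ∩ ⋂ t, {x | g t x ≤ 0}) :=
    hS.inter (IsPolyhedron.iInter fun t => IsPolyhedron.setOf_nonpos _)
  obtain ⟨l, hlf, hlS⟩ := exists_affine_between hf hSg.convex ⟨x₀, hx₀, by simpa using hg⟩
    (m := f x₀) (fun x hx => hmin x hx.1 (by simpa using hx.2))
  obtain ⟨T, rfl⟩ := hS
  obtain ⟨μ, hμ, h⟩ := affine_farkas (Finset.univ : Finset (T ⊕ κ)) (Sum.elim (fun i => i.1) g)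
    (l - AffineMap.const ℝ X (f x₀)) (x₀ := x₀)
    (by rintro (i | t) -
        · exact hx₀ i i.2
        · exact hg t)
    (fun x hx => by
      have h := hlS x ⟨fun i hi => hx (Sum.inl ⟨i, hi⟩) (Finset.mem_univ _),
        by simpa using fun t => hx (Sum.inr t) (Finset.mem_univ _)⟩
      simpa using h)
  refine ⟨fun t => μ (Sum.inr t), fun t => hμ _, fun x hx => ?_⟩
  have h1 := h x
  simp only [Fintype.sum_sum_type, Sum.elim_inl, Sum.elim_inr, AffineMap.coe_sub, Pi.sub_apply,
    AffineMap.const_apply] at h1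
  have h2 : ∑ i : T, μ (Sum.inl i) * i.1 x ≤ 0 :=
    Finset.sum_nonpos fun i _ => mul_nonpos_of_nonneg_of_nonpos (hμ _) (hx i i.2)
  linarith [hlf x]

end Multipliers

/-! ### Consensus ADMM -/

section ADMM

variable {X : Type*} [NormedAddCommGroup X] [NormedSpace ℝ X] {B : X →ₗ[ℝ] X →ₗ[ℝ] ℝ}

theorem tendsto_of_bilin_sub_tendsto_zero (hpos : ∀ x, ‖x‖ ^ 2 ≤ B x x) {α : Type*}
    {l : Filter α} {f : α → X} {x : X} (h : Tendsto (fun a => B (f a - x) (f a - x)) l (𝓝 0)) :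
    Tendsto f l (𝓝 x) := by
  rw [tendsto_iff_norm_sub_tendsto_zero]
  have h2 : Tendsto (fun a => ‖f a - x‖ ^ 2) l (𝓝 0) :=
    squeeze_zero (fun _ => by positivity) (fun a => hpos _) h
  have h3 := (Real.continuous_sqrt.tendsto 0).comp h2
  simpa [Function.comp_def] using h3

/-- The Lyapunov inequality of consensus ADMM. A saddle point is `(ws, θs)`, with the multiplier
`θs` orthogonal to the subspace `R` of consensus; the primed variables are those of the next step. -/
theorem admm_descent (hsymm : ∀ x y, B x y = B y x) {F : X → ℝ} {R : Submodule ℝ X}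
    {ρ : ℝ} (hρ : 0 < ρ) {w' v v' θ θ' ws θs : X}
    (hvi : 0 ≤ F ws - F w' + B (θ + ρ • (w' - v)) (ws - w'))
    (hθ' : θ' = θ + ρ • (w' - v')) (hv : v ∈ R) (hv' : v' ∈ R) (hws : ws ∈ R)
    (hθR : ∀ r ∈ R, B θ r = 0) (hθR' : ∀ r ∈ R, B θ' r = 0) (hθs : ∀ r ∈ R, B θs r = 0)
    (hsaddle : F ws ≤ F w' + B θs w') :
    (1 / ρ * B (θ' - θs) (θ' - θs) + ρ * B (v' - ws) (v' - ws))
      + (1 / ρ * B (θ' - θ) (θ' - θ) + ρ * B (v' - v) (v' - v)) ≤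
    1 / ρ * B (θ - θs) (θ - θs) + ρ * B (v - ws) (v - ws) := by
  have hw' : w' = v' + (1 / ρ) • (θ' - θ) := by
    rw [hθ', add_sub_cancel_left, smul_smul, one_div, inv_mul_cancel₀ hρ.ne', one_smul]
    abel
  have hcoef : θ + ρ • (w' - v) = θ' + ρ • (v' - v) := by
    rw [hθ', smul_sub, smul_sub, smul_sub]
    abel
  rw [hcoef] at hvi
  subst hw'
  simp only [map_add, map_sub, map_smul, LinearMap.add_apply, LinearMap.sub_apply,
    LinearMap.smul_apply, smul_eq_mul, hθR _ hv, hθR _ hv', hθR' _ hv, hθR' _ hv',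
    hθR' _ hws, hθs _ hv', hsymm v θ, hsymm v' θ, hsymm v θ', hsymm v' θ', hsymm θ' θ, hsymm θs θ, hsymm θs θ', hsymm v' v, hsymm ws v,
    hsymm ws v'] at hvi hsaddle ⊢
  have h1 : ρ * (1 / ρ) = 1 := by field_simp
  nlinarith

variable [FiniteDimensional ℝ X]

theorem tendsto_bilin {α : Type*} {l : Filter α} {f g : α → X} {x y : X}
    (hf : Tendsto f l (𝓝 x)) (hg : Tendsto g l (𝓝 y)) :
    Tendsto (fun a => B (f a) (g a)) l (𝓝 (B x y)) := by
  have h : Continuous fun p : X × X => B p.1 p.2 :=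
    B.toContinuousBilinearMap.continuous₂
  exact (h.tendsto (x, y)).comp (hf.prodMk_nhds hg)

/-- A strongly convex function attains its minimum on a closed set. -/
theorem exists_proximal_point (hpos : ∀ x, ‖x‖ ^ 2 ≤ B x x) {F : X → ℝ}
    (hF : ConvexOn ℝ Set.univ F) {C : Set X} (hC : IsClosed C) (hne : C.Nonempty) {ρ : ℝ}
    (hρ : 0 < ρ) (c : X) :
    ∃ v ∈ C, ∀ z ∈ C, F v + ρ / 2 * B (v - c) (v - c) ≤ F z + ρ / 2 * B (z - c) (z - c) := by
  obtain ⟨l, hl, -⟩ := exists_affine_between hF (convex_singleton (0 : X)) (by simp)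
    (m := F 0) (by simp)
  have hcont : Continuous fun z => F z + ρ / 2 * B (z - c) (z - c) :=
    (continuous_of_convexOn hF).add (continuous_const.mul (continuous_iff_continuousAt.2 fun x =>
      tendsto_bilin ((continuous_id.sub continuous_const).tendsto x)
        ((continuous_id.sub continuous_const).tendsto x)))
  let L : X →L[ℝ] ℝ := LinearMap.toContinuousLinearMap l.linear
  have hlow : ∀ z, l c + ‖z - c‖ * (ρ / 2 * ‖z - c‖ - ‖L‖) ≤
      F z + ρ / 2 * B (z - c) (z - c) := fun z => by
    have h1 : l z = L (z - c) + l c := by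
      have := l.map_vadd c (z - c)
      rwa [vadd_eq_add, sub_add_cancel, vadd_eq_add] at this
    have h2 := (abs_le.1 ((Real.norm_eq_abs _).symm.le.trans (L.le_opNorm (z - c)))).1
    have h3 := mul_le_mul_of_nonneg_left (hpos (z - c)) (by linarith : 0 ≤ ρ / 2)
    nlinarith [hl z]
  have hnorm : Tendsto (fun z => ‖z - c‖) (cocompact X) atTop :=
    tendsto_atTop_mono (fun z => norm_sub_norm_le z c)
      (tendsto_atTop_add_const_right _ (-‖c‖) (tendsto_norm_cocompact_atTop (E := X)))
  have hinf : Tendsto (fun z => F z + ρ / 2 * B (z - c) (z - c)) (cocompact X) atTop :=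
    tendsto_atTop_mono hlow (tendsto_atTop_add_const_left _ _ (hnorm.atTop_mul_atTop₀
      (tendsto_atTop_add_const_right _ (-‖L‖) (hnorm.const_mul_atTop (by linarith)))))
  obtain ⟨x₀, hx₀⟩ := hne
  obtain ⟨v, hv, hmin⟩ := hcont.continuousOn.exists_isMinOn' hC hx₀
    ((hinf.eventually_ge_atTop _).filter_mono inf_le_left)
  exact ⟨v, hv, fun z hz => hmin hz⟩

/-- Convergence of consensus ADMM with the blocks `w` and `v` and the coupling `w = v ∈ R`. The
step for `w` enters through its variational inequality. The multipliers of the steps are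
orthogonal to `R` from the first update on. -/
theorem consensus_admm_tendsto (hsymm : ∀ x y, B x y = B y x) (hpos : ∀ x, ‖x‖ ^ 2 ≤ B x x)
    {F : X → ℝ} (hF : Continuous F) {C : Set X} (hC : IsClosed C) {R : Submodule ℝ X}
    {ρ : ℝ} (hρ : 0 < ρ) {w v θ : ℕ → X} (hw : ∀ n, w (n + 1) ∈ C)
    (hvi : ∀ n, ∀ z ∈ C,
      0 ≤ F z - F (w (n + 1)) + B (θ n + ρ • (w (n + 1) - v n)) (z - w (n + 1)))
    (hv : ∀ n, v (n + 1) ∈ R) (hθ : ∀ n, θ (n + 1) = θ n + ρ • (w (n + 1) - v (n + 1)))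
    (hθR : ∀ n, ∀ r ∈ R, B (θ (n + 1)) r = 0)
    (hsaddle : ∃ ws ∈ C, ws ∈ R ∧ ∃ θs, (∀ r ∈ R, B θs r = 0) ∧
      ∀ z ∈ C, F ws ≤ F z + B θs z) :
    ∃ wl ∈ C, wl ∈ R ∧ (∀ z ∈ C, z ∈ R → F wl ≤ F z) ∧ Tendsto w atTop (𝓝 wl) := by
  have hnn : ∀ x, 0 ≤ B x x := fun x => (sq_nonneg _).trans (hpos x)
  have hρi : 0 < 1 / ρ := one_div_pos.2 hρ
  let Φ : X → X → ℕ → ℝ := fun ws θs n =>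
    1 / ρ * B (θ (n + 1) - θs) (θ (n + 1) - θs) + ρ * B (v (n + 1) - ws) (v (n + 1) - ws)
  let Δ : ℕ → ℝ := fun n => 1 / ρ * B (θ (n + 2) - θ (n + 1)) (θ (n + 2) - θ (n + 1))
    + ρ * B (v (n + 2) - v (n + 1)) (v (n + 2) - v (n + 1))
  have hΦ0 : ∀ ws θs n, 0 ≤ Φ ws θs n := fun ws θs n =>
    add_nonneg (mul_nonneg hρi.le (hnn _)) (mul_nonneg hρ.le (hnn _))
  have hΔ0 : ∀ n, 0 ≤ Δ n := fun n =>
    add_nonneg (mul_nonneg hρi.le (hnn _)) (mul_nonneg hρ.le (hnn _))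
  have hdesc : ∀ ws ∈ C, ws ∈ R → ∀ θs, (∀ r ∈ R, B θs r = 0) →
      (∀ z ∈ C, F ws ≤ F z + B θs z) → ∀ n, Φ ws θs (n + 1) + Δ n ≤ Φ ws θs n :=
    fun ws hwsC hwsR θs hθs hs n => admm_descent hsymm hρ (hvi (n + 1) ws hwsC) (hθ (n + 1))
      (hv n) (hv (n + 1)) hwsR (hθR n) (hθR (n + 1)) hθs (hs _ (hw (n + 1)))
  have hanti : ∀ ws ∈ C, ws ∈ R → ∀ θs, (∀ r ∈ R, B θs r = 0) →
      (∀ z ∈ C, F ws ≤ F z + B θs z) → Antitone (Φ ws θs) :=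
    fun ws hwsC hwsR θs hθs hs => antitone_nat_of_succ_le fun n => by
      have := hdesc ws hwsC hwsR θs hθs hs n
      linarith [hΔ0 n]
  -- Each of the two blocks is controlled by their weighted sum.
  have hfst : ∀ {s t : ℝ}, 0 ≤ t → s ≤ ρ * (1 / ρ * s + ρ * t) := fun {s t} ht => by
    rw [mul_add, ← mul_assoc ρ (1 / ρ), mul_one_div_cancel hρ.ne', one_mul]
    exact le_add_of_nonneg_right (mul_nonneg hρ.le (mul_nonneg hρ.le ht))
  have hsnd : ∀ {s t : ℝ}, 0 ≤ s → t ≤ 1 / ρ * (1 / ρ * s + ρ * t) := fun {s t} hs => by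
    rw [mul_add, ← mul_assoc (1 / ρ) ρ, one_div_mul_cancel hρ.ne', one_mul]
    exact le_add_of_nonneg_left (mul_nonneg hρi.le (mul_nonneg hρi.le hs))
  have hsplit : ∀ {a b : ℕ → X},
      Tendsto (fun n => 1 / ρ * B (a n) (a n) + ρ * B (b n) (b n)) atTop (𝓝 0) →
      Tendsto a atTop (𝓝 0) ∧ Tendsto b atTop (𝓝 0) := by
    intro a b h0
    constructor
    · refine tendsto_of_bilin_sub_tendsto_zero (B := B) hpos ?_
      simp only [sub_zero]
      exact squeeze_zero (fun n => hnn _) (fun n => hfst (hnn (b n)))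
        (by simpa only [mul_zero] using h0.const_mul ρ)
    · refine tendsto_of_bilin_sub_tendsto_zero (B := B) hpos ?_
      simp only [sub_zero]
      exact squeeze_zero (fun n => hnn _) (fun n => hsnd (hnn (a n)))
        (by simpa only [mul_zero] using h0.const_mul (1 / ρ))
  obtain ⟨ws, hwsC, hwsR, θs, hθs, hs⟩ := hsaddle
  have hΔ : Tendsto Δ atTop (𝓝 0) := by
    have hlim := tendsto_atTop_ciInf (hanti ws hwsC hwsR θs hθs hs)
      ⟨0, by rintro _ ⟨n, rfl⟩; exact hΦ0 _ _ _⟩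
    have := hlim.sub ((tendsto_add_atTop_iff_nat 1).2 hlim)
    rw [sub_self] at this
    exact squeeze_zero hΔ0 (fun n => by
      have := hdesc ws hwsC hwsR θs hθs hs n
      linarith) this
  obtain ⟨hdθ, hdv⟩ := hsplit hΔ
  have hw_eq : ∀ n, w (n + 1) = v (n + 1) + (1 / ρ) • (θ (n + 1) - θ n) := fun n => by
    rw [hθ n, add_sub_cancel_left, smul_smul, one_div, inv_mul_cancel₀ hρ.ne', one_smul]
    abel
  -- The pairs `(v n, θ n)` are bounded, hence have a cluster point.
  have hbdd : ∃ K, ∀ n, (v (n + 1), θ (n + 1)) ∈ Metric.closedBall (ws, θs) K := by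
    refine ⟨max (√(1 / ρ * Φ ws θs 0)) (√(ρ * Φ ws θs 0)), fun n => ?_⟩
    have hle := hanti ws hwsC hwsR θs hθs hs (Nat.zero_le n)
    rw [Metric.mem_closedBall, Prod.dist_eq, dist_eq_norm, dist_eq_norm]
    refine max_le_max (Real.le_sqrt_of_sq_le ((hpos _).trans ?_))
      (Real.le_sqrt_of_sq_le ((hpos _).trans ?_))
    · exact (hsnd (hnn _)).trans (mul_le_mul_of_nonneg_left hle hρi.le)
    · exact (hfst (hnn _)).trans (mul_le_mul_of_nonneg_left hle hρ.le)
  obtain ⟨K, hK⟩ := hbdd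
  obtain ⟨⟨vl, θl⟩, -, φ, hφ, hlim⟩ := tendsto_subseq_of_bounded Metric.isBounded_closedBall hK
  have hvφ : Tendsto (fun n => v (φ n + 1)) atTop (𝓝 vl) := (Prod.tendsto_iff _ _).1 hlim |>.1
  have hθφ : Tendsto (fun n => θ (φ n + 1)) atTop (𝓝 θl) := (Prod.tendsto_iff _ _).1 hlim |>.2
  have hvlR : vl ∈ R := R.closed_of_finiteDimensional.mem_of_tendsto hvφ
    (Eventually.of_forall fun n => hv _)
  have hθlR : ∀ r ∈ R, B θl r = 0 := fun r hr =>
    tendsto_nhds_unique (tendsto_bilin hθφ tendsto_const_nhds)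
      (tendsto_const_nhds.congr fun n => (hθR (φ n) r hr).symm)
  have hdw : Tendsto (fun n => w (n + 2) - v (n + 1)) atTop (𝓝 0) := by
    have := hdv.add (hdθ.const_smul (1 / ρ))
    rw [smul_zero, add_zero] at this
    refine this.congr fun n => ?_
    rw [hw_eq (n + 1)]
    abel
  have hwφ : Tendsto (fun n => w (φ n + 2)) atTop (𝓝 vl) := by
    have := hvφ.add (hdw.comp hφ.tendsto_atTop)
    rw [add_zero] at this
    exact this.congr fun n => by simp
  have hvlC : vl ∈ C := hC.mem_of_tendsto hwφ (Eventually.of_forall fun n => hw _)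
  have hsl : ∀ z ∈ C, F vl ≤ F z + B θl z := fun z hz => by
    have h1 : Tendsto (fun n => F z - F (w (φ n + 2))
        + B (θ (φ n + 1) + ρ • (w (φ n + 2) - v (φ n + 1))) (z - w (φ n + 2))) atTop
        (𝓝 (F z - F vl + B (θl + ρ • (0 : X)) (z - vl))) :=
      (tendsto_const_nhds.sub ((hF.tendsto vl).comp hwφ)).add
        (tendsto_bilin (hθφ.add ((hdw.comp hφ.tendsto_atTop).const_smul ρ))
          (tendsto_const_nhds.sub hwφ))
    have h2 := ge_of_tendsto' h1 fun n => hvi (φ n + 1) z hz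
    rw [smul_zero, add_zero, map_sub, hθlR vl hvlR] at h2
    linarith
  refine ⟨vl, hvlC, hvlR, fun z hz hzR => ?_, ?_⟩
  · have := hsl z hz
    rwa [hθlR z hzR, add_zero] at this
  -- Along the subsequence `Φ vl θl` tends to zero; being antitone, it tends to zero.
  have hΦφ : Tendsto (fun n => Φ vl θl (φ n)) atTop (𝓝 0) := by
    have h1 := hθφ.sub_const θl
    have h2 := hvφ.sub_const vl
    have := ((tendsto_bilin (B := B) h1 h1).const_mul (1 / ρ)).add
      ((tendsto_bilin (B := B) h2 h2).const_mul ρ)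
    rwa [sub_self, sub_self, map_zero, mul_zero, mul_zero, add_zero] at this
  have hΦ : Tendsto (Φ vl θl) atTop (𝓝 0) := by
    have hlim := tendsto_atTop_ciInf (hanti vl hvlC hvlR θl hθlR hsl)
      ⟨0, by rintro _ ⟨n, rfl⟩; exact hΦ0 _ _ _⟩
    rwa [tendsto_nhds_unique (hlim.comp hφ.tendsto_atTop) hΦφ] at hlim
  have hvlim := (hsplit hΦ).2
  refine (tendsto_add_atTop_iff_nat 2).1 ?_
  have := (hdw.add hvlim).add_const vl
  rw [add_zero, zero_add] at this
  exact this.congr fun n => by abel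

end ADMM

/-! ### Dual consensus over a connected graph -/

section Graph

variable {V : Type*}

/-- Along a path from `j` to `i`, any vector can be shipped by an antisymmetric edge flow. -/
theorem exists_flow_of_reachable [Fintype V] [DecidableEq V] {G : SimpleGraph V}
    {nb : V → Finset V} (hnb : ∀ i j, j ∈ nb i ↔ G.Adj i j) {i j : V} (h : G.Reachable i j)
    (c : ℝ) :
    ∃ g : V → V → ℝ, (∀ a b, g a b = -g b a) ∧
      ∀ a, ∑ b ∈ nb a, g a b = (Pi.single i c : V → ℝ) a - (Pi.single j c : V → ℝ) a := by
  obtain ⟨p⟩ := h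
  induction p with
  | nil => exact ⟨0, by simp, by simp⟩
  | @cons i m j hadj p ih =>
    obtain ⟨g, hg, hdiv⟩ := ih
    refine ⟨fun a b => g a b + ((if a = i ∧ b = m then c else 0) - if a = m ∧ b = i then c else 0),
      fun a b => ?_, fun a => ?_⟩
    · dsimp only
      simp only [hg a b, and_comm (a := b = i), and_comm (a := b = m)]
      ring
    · have h1 : ∑ b ∈ nb a, (if a = i ∧ b = m then c else 0) = (Pi.single i c : V → ℝ) a := by
        rcases eq_or_ne a i with rfl | ha
        · simp [hnb, hadj]
        · simp [ha]
      have h2 : ∑ b ∈ nb a, (if a = m ∧ b = i then c else 0) = (Pi.single m c : V → ℝ) a := by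
        rcases eq_or_ne a m with rfl | ha
        · simp [hnb, hadj.symm]
        · simp [ha]
      rw [Finset.sum_add_distrib, Finset.sum_sub_distrib, hdiv, h1, h2]
      ring

/-- On a connected graph every function with sum zero is the divergence of an edge flow. -/
theorem exists_flow [Fintype V] {G : SimpleGraph V} (hG : G.Connected)
    {nb : V → Finset V} (hnb : ∀ i j, j ∈ nb i ↔ G.Adj i j) {b : V → ℝ} (hb : ∑ i, b i = 0) :
    ∃ g : V → V → ℝ, (∀ i j, g i j = -g j i) ∧ ∀ i, ∑ j ∈ nb i, g i j = b i := by
  classical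
  obtain ⟨r⟩ := hG.nonempty
  choose g hg hdiv using fun i => exists_flow_of_reachable hnb (hG.preconnected i r) (b i)
  refine ⟨fun a c => ∑ i, g i a c, fun a c => ?_, fun a => ?_⟩
  · rw [← Finset.sum_neg_distrib]
    exact Finset.sum_congr rfl fun i _ => hg i a c
  · rw [Finset.sum_comm]
    simp only [hdiv, Finset.sum_sub_distrib]
    have h1 : ∑ i, (Pi.single r (b i) : V → ℝ) a = (Pi.single r (∑ i, b i) : V → ℝ) a := by
      rcases eq_or_ne a r with rfl | ha
      · simp
      · simp [ha]
    rw [h1, hb]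
    simp [Pi.single_apply]

theorem sum_nbrs_symmetrize [Fintype V] {nb : V → Finset V} (hnb : ∀ i j, j ∈ nb i ↔ i ∈ nb j)
    (T : V → V → ℝ) :
    2 * ∑ i, ∑ j ∈ nb i, T i j = ∑ i, ∑ j ∈ nb i, (T i j + T j i) := by
  have h : ∑ i, ∑ j ∈ nb i, T j i = ∑ i, ∑ j ∈ nb i, T i j :=
    Finset.sum_comm' fun i j => by simp [hnb i j]
  simp only [Finset.sum_add_distrib, h]
  ring

/-- The Lyapunov function of dual-consensus ADMM: `m i` is the deviation of the local price of
agent `i` from the optimal price, `a i j` that of the edge variables from an optimal flow. -/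
def dualLyapunov [Fintype V] (nb : V → Finset V) (ρ : ℝ) (a : V → V → ℝ) (m : V → ℝ) : ℝ :=
  ∑ i, ∑ j ∈ nb i, (1 / ρ * a i j ^ 2 + ρ / 4 * (m i + m j) ^ 2)

theorem dualLyapunov_nonneg [Fintype V] (nb : V → Finset V) {ρ : ℝ} (hρ : 0 < ρ)
    (a : V → V → ℝ) (m : V → ℝ) : 0 ≤ dualLyapunov nb ρ a m :=
  Finset.sum_nonneg fun _ _ => Finset.sum_nonneg fun _ _ => by positivity

theorem dualLyapunov_sub_le [Fintype V] {nb : V → Finset V} (hnb : ∀ i j, j ∈ nb i ↔ i ∈ nb j)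
    {ρ : ℝ} (hρ : 0 < ρ) {a a' : V → V → ℝ} {m m' : V → ℝ}
    (ha : ∀ i, ∀ j ∈ nb i, a i j = -a j i)
    (ha' : ∀ i, ∀ j ∈ nb i, a' i j = a i j + ρ / 2 * (m' i - m' j)) :
    dualLyapunov nb ρ a' m' - dualLyapunov nb ρ a m ≤
      ∑ i, m' i * ∑ j ∈ nb i, (2 * a i j + ρ * (2 * m' i - m i - m j)) := by
  simp only [dualLyapunov, Finset.mul_sum, ← Finset.sum_sub_distrib]
  refine le_of_mul_le_mul_left ?_ (two_pos (α := ℝ))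
  rw [sum_nbrs_symmetrize hnb, sum_nbrs_symmetrize hnb]
  refine Finset.sum_le_sum fun i _ => Finset.sum_le_sum fun j hj => ?_
  have hji : a j i = -a i j := by rw [ha i j hj, neg_neg]
  rw [ha' i j hj, ha' j i ((hnb i j).1 hj), hji]
  have h1 : 1 / ρ * (a i j + ρ / 2 * (m' i - m' j)) ^ 2 = 1 / ρ * a i j ^ 2
      + a i j * (m' i - m' j) + ρ / 4 * (m' i - m' j) ^ 2 := by
    field_simp
    ring
  have h2 : 1 / ρ * (-a i j + ρ / 2 * (m' j - m' i)) ^ 2 = 1 / ρ * a i j ^ 2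
      + a i j * (m' i - m' j) + ρ / 4 * (m' i - m' j) ^ 2 := by
    field_simp
    ring
  rw [h1, h2]
  have h3 : 0 ≤ ρ / 2 * (m' i - m' j) ^ 2 := by positivity
  have h4 : 0 ≤ ρ / 2 * (m' i + m' j - m i - m j) ^ 2 := by positivity
  linarith

end Graph

/-! ### The road network model in input variables -/

section Net

variable {V : Type*} [Fintype V] (E : Digraph V) (N : ℕ)

theorem mem_nbrs {i j : V} : j ∈ nbrs E i ↔ (nbrGraph E).Adj i j := by simp [nbrs]

theorem mem_hood {i j : V} : j ∈ hood E i ↔ j = i ∨ (nbrGraph E).Adj i j := by simp [hood]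

theorem mem_hood_comm {i j : V} : j ∈ hood E i ↔ i ∈ hood E j := by
  rw [mem_hood, mem_hood, SimpleGraph.adj_comm, eq_comm]

/-- The selection matrix `E_i` as a linear map. -/
def selectₗ (i : V) : (V → Inputs N) →ₗ[ℝ] Copies E N i where
  toFun := select E i
  map_add' _ _ := rfl
  map_smul' _ _ := rfl

/-- The stacked selection matrices `u ↦ (E_i u)_i`. -/
def selectAll : (V → Inputs N) →ₗ[ℝ] ((i : V) → Copies E N i) :=
  LinearMap.pi fun i => selectₗ E N i

/-- The transposed selection matrix `E_iᵀ` as a linear map. -/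
def unselectₗ (i : V) : Copies E N i →ₗ[ℝ] (V → Inputs N) where
  toFun := unselect
  map_add' w w' := by
    funext j
    by_cases h : j ∈ hood E i <;> simp [unselect, h]
  map_smul' r w := by
    funext j
    by_cases h : j ∈ hood E i <;> simp [unselect, h]

variable {E N}

theorem unselect_select {i j : V} (hj : j ∈ hood E i) (u : V → Inputs N) :
    unselect (select E i u) j = u j := by
  simp [unselect, select, hj]

/-- Euclidean inner product of local decision variables. -/
def copiesInner (i : V) : Copies E N i →ₗ[ℝ] Copies E N i →ₗ[ℝ] ℝ :=
  LinearMap.mk₂ ℝ (fun w w' => ∑ j, ∑ k, ∑ c, w j k c * w' j k c)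
    (fun _ _ _ => by simp only [Pi.add_apply, add_mul, Finset.sum_add_distrib])
    (fun _ _ _ => by simp only [Pi.smul_apply, smul_eq_mul, mul_assoc, Finset.mul_sum])
    (fun _ _ _ => by simp only [Pi.add_apply, mul_add, Finset.sum_add_distrib])
    (fun _ _ _ => by simp only [Pi.smul_apply, smul_eq_mul, mul_left_comm, Finset.mul_sum])

theorem copiesInner_apply {i : V} (w w' : Copies E N i) :
    copiesInner i w w' = ∑ j, ∑ k, ∑ c, w j k c * w' j k c := rfl

theorem copiesInner_comm {i : V} (w w' : Copies E N i) :
    copiesInner i w w' = copiesInner i w' w := by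
  simp only [copiesInner_apply, mul_comm]

theorem sqNorm_eq {i : V} (w : Copies E N i) : sqNorm w = copiesInner i w w := by
  simp only [copiesInner_apply, sqNorm, pow_two]

theorem norm_sq_le_copiesInner {i : V} (w : Copies E N i) : ‖w‖ ^ 2 ≤ copiesInner i w w := by
  rw [← sqNorm_eq]
  have h0 : 0 ≤ sqNorm w := by unfold sqNorm; positivity
  refine (Real.le_sqrt (norm_nonneg _) h0).1 ?_
  refine (pi_norm_le_iff_of_nonneg (Real.sqrt_nonneg _)).2 fun j =>
    (pi_norm_le_iff_of_nonneg (Real.sqrt_nonneg _)).2 fun k =>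
    (pi_norm_le_iff_of_nonneg (Real.sqrt_nonneg _)).2 fun c => Real.abs_le_sqrt ?_
  have h1 : w j k c ^ 2 ≤ ∑ c, w j k c ^ 2 :=
    Finset.single_le_sum (f := fun c => w j k c ^ 2) (fun _ _ => sq_nonneg _) (Finset.mem_univ c)
  have h2 : ∑ c, w j k c ^ 2 ≤ ∑ k, ∑ c, w j k c ^ 2 :=
    Finset.single_le_sum (f := fun k => ∑ c, w j k c ^ 2)
      (fun _ _ => Finset.sum_nonneg fun _ _ => sq_nonneg _) (Finset.mem_univ k)
  have h3 : ∑ k, ∑ c, w j k c ^ 2 ≤ sqNorm w :=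
    Finset.single_le_sum (f := fun j => ∑ k, ∑ c, w j k c ^ 2)
      (fun _ _ => Finset.sum_nonneg fun _ _ => Finset.sum_nonneg fun _ _ => sq_nonneg _)
      (Finset.mem_univ j)
  exact h1.trans (h2.trans h3)

/-- Euclidean inner product of the decision variables of all agents. -/
def netInner : ((i : V) → Copies E N i) →ₗ[ℝ] ((i : V) → Copies E N i) →ₗ[ℝ] ℝ :=
  ∑ i, (copiesInner i).compl₁₂ (LinearMap.proj i) (LinearMap.proj i)

theorem netInner_apply (w w' : (i : V) → Copies E N i) :
    netInner w w' = ∑ i, copiesInner i (w i) (w' i) := by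
  simp [netInner]

theorem netInner_comm (w w' : (i : V) → Copies E N i) : netInner w w' = netInner w' w := by
  simp only [netInner_apply]
  exact Finset.sum_congr rfl fun i _ => copiesInner_comm _ _

theorem norm_sq_le_netInner (w : (i : V) → Copies E N i) : ‖w‖ ^ 2 ≤ netInner w w := by
  have hnn : ∀ i, 0 ≤ copiesInner i (w i) (w i) := fun i =>
    (sq_nonneg _).trans (norm_sq_le_copiesInner _)
  rw [netInner_apply]
  refine (Real.le_sqrt (norm_nonneg _) (Finset.sum_nonneg fun i _ => hnn i)).1 ?_
  refine (pi_norm_le_iff_of_nonneg (Real.sqrt_nonneg _)).2 fun i => Real.le_sqrt_of_sq_le ?_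
  exact (norm_sq_le_copiesInner _).trans
    (Finset.single_le_sum (f := fun i => copiesInner i (w i) (w i)) (fun i _ => hnn i)
      (Finset.mem_univ i))

/-- `∑ E_iᵀ` is the adjoint of the stacked selection `u ↦ (E_i u)_i`. -/
theorem netInner_selectAll (w : (i : V) → Copies E N i) (u : V → Inputs N) :
    netInner w (selectAll E N u) = ∑ j, ∑ k, ∑ c, (∑ i, unselect (w i) j) k c * u j k c := by
  have h : ∀ i, copiesInner i (w i) (selectAll E N u i) =
      ∑ j, ∑ k, ∑ c, unselect (w i) j k c * u j k c := fun i => by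
    rw [copiesInner_apply, ← Finset.sum_subset (Finset.subset_univ (hood E i)),
      Finset.sum_coe_sort_eq_attach, ← Finset.sum_attach (hood E i)]
    · refine Finset.sum_congr rfl fun j _ => Finset.sum_congr rfl fun k _ =>
        Finset.sum_congr rfl fun c _ => ?_
      rw [unselect, dif_pos j.2]
      rfl
    · intro j _ hj
      simp [unselect, hj]
  simp only [netInner_apply, h, Finset.sum_apply, Finset.sum_mul]
  rw [Finset.sum_comm]
  refine Finset.sum_congr rfl fun j _ => ?_
  rw [Finset.sum_comm]
  exact Finset.sum_congr rfl fun k _ => Finset.sum_comm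

theorem sum_unselect_select (u : V → Inputs N) (j : V) :
    ∑ i, unselect (select E i u) j = ((hood E j).card : ℝ) • u j := by
  classical
  have h : ∀ i, unselect (select E i u) j = if i ∈ hood E j then u j else 0 := fun i => by
    simp only [unselect, select, mem_hood_comm E (i := i) (j := j)]
    split_ifs <;> rfl
  simp only [h, Finset.sum_ite_mem, Finset.univ_inter, Finset.sum_const, Nat.cast_smul_eq_nsmul]

end Net

namespace Problem

variable {V : Type*} [Fintype V] {N : ℕ} (P : Problem V N)

open Classical in
/-- The part of the state increment of subnetwork `j` at step `k` that is linear in the inputs. -/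
def increment (j : V) (k : Fin N) : (V → Inputs N) →ₗ[ℝ] (Fin 2 → ℝ) :=
  (P.B j j k).mulVecLin ∘ₗ LinearMap.proj k ∘ₗ LinearMap.proj j +
    ∑ m ∈ Finset.univ.filter (fun m => m ≠ j ∧ P.E.Adj m j),
      (P.B j m k).mulVecLin ∘ₗ LinearMap.proj k ∘ₗ LinearMap.proj m

/-- The state trajectory of subnetwork `j` as an affine function of all inputs. -/
def trajectory (j : V) : (V → Inputs N) →ᵃ[ℝ] States N :=
  (LinearMap.pi fun k : Fin (N + 1) =>
      ∑ l ∈ Finset.univ.filter (fun l : Fin N => l.castSucc < k), P.increment j l).toAffineMap +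
    AffineMap.const ℝ _ fun k : Fin (N + 1) =>
      P.x₀ j + ∑ l ∈ Finset.univ.filter (fun l : Fin N => l.castSucc < k), P.ψ j l

theorem trajectory_apply (j : V) (u : V → Inputs N) (k : Fin (N + 1)) :
    P.trajectory j u k =
      ∑ l ∈ Finset.univ.filter (fun l : Fin N => l.castSucc < k), P.increment j l u +
      (P.x₀ j + ∑ l ∈ Finset.univ.filter (fun l : Fin N => l.castSucc < k), P.ψ j l) := by
  simp [trajectory]

theorem trajectory_zero (j : V) (u : V → Inputs N) : P.trajectory j u 0 = P.x₀ j := by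
  simp [trajectory_apply]

theorem trajectory_succ (j : V) (u : V → Inputs N) (k : Fin N) :
    P.trajectory j u k.succ =
      P.trajectory j u k.castSucc + P.increment j k u + P.ψ j k := by
  have h : Finset.univ.filter (fun l : Fin N => l.castSucc < k.succ) =
      insert k (Finset.univ.filter fun l : Fin N => l.castSucc < k.castSucc) := by
    ext l
    simp only [Finset.mem_filter, Finset.mem_univ, true_and, Finset.mem_insert, Fin.lt_def,
      Fin.ext_iff, Fin.val_castSucc, Fin.val_succ]
    omega
  rw [trajectory_apply, trajectory_apply, h, Finset.sum_insert (by simp),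
    Finset.sum_insert (by simp)]
  abel

theorem evolves_iff (j : V) (u : V → Inputs N) (x : States N) :
    P.Evolves j u x ↔ x = P.trajectory j u := by
  have hinc : ∀ k, P.increment j k u = (P.B j j k).mulVec (u j k) +
      ∑ m ∈ (by classical exact Finset.univ.filter (fun m => m ≠ j ∧ P.E.Adj m j)),
        (P.B j m k).mulVec (u m k) := fun k => by
    simp [increment]
  constructor
  · rintro ⟨h0, hs⟩
    funext k
    induction k using Fin.induction with
    | zero => rw [h0, trajectory_zero]
    | succ k ih => rw [hs k, trajectory_succ, hinc, ih, ← add_assoc]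
  · rintro rfl
    exact ⟨P.trajectory_zero j u, fun k => by rw [trajectory_succ, hinc, ← add_assoc]⟩

theorem trajectory_congr {j : V} {u u' : V → Inputs N}
    (h : ∀ m, m = j ∨ P.E.Adj m j → u m = u' m) : P.trajectory j u = P.trajectory j u' := by
  classical
  have hinc : ∀ k, P.increment j k u = P.increment j k u' := fun k => by
    simp only [increment, LinearMap.add_apply, LinearMap.sum_apply, LinearMap.comp_apply,
      LinearMap.proj_apply, h j (Or.inl rfl)]
    congr 1
    refine Finset.sum_congr rfl fun m hm => ?_
    rw [h m (Or.inr (Finset.mem_filter.1 hm).2.2)]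
  funext k
  simp only [trajectory_apply, hinc]

/-- The inputs that enter the states of `i` and of the subnetworks downstream of `i` are those of
`i` and its neighbours. -/
theorem trajectory_unselect_select {i j : V} (hj : j = i ∨ P.E.Adj i j) (u : V → Inputs N) :
    P.trajectory j (unselect (select P.E i u)) = P.trajectory j u := by
  refine P.trajectory_congr fun m hm => unselect_select ((mem_hood _).2 ?_) u
  by_cases hmi : m = i
  · exact Or.inl hmi
  · refine Or.inr ⟨Ne.symm hmi, ?_⟩
    rcases hj with rfl | hj <;> rcases hm with rfl | hm
    · exact absurd rfl hmi
    · exact Or.inr (Or.inl hm)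
    · exact Or.inl hj
    · exact Or.inr (Or.inr ⟨j, hj, hm⟩)

theorem flowConstraints_congr {i : V} {u u' : V → Inputs N} {x x' : V → States N}
    (hu : u i = u' i) (hx : ∀ j, j = i ∨ P.E.Adj i j → x j = x' j) :
    P.FlowConstraints i u x ↔ P.FlowConstraints i u' x' := by
  have h : ∀ k j, (P.E.Adj i j → u' i k 1 * (1 - P.β i k) + u' i k 0 ≤
        min (P.φmax j) (P.ω * (P.ρmax j - x j k.castSucc 0))) ↔
      (P.E.Adj i j → u' i k 1 * (1 - P.β i k) + u' i k 0 ≤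
        min (P.φmax j) (P.ω * (P.ρmax j - x' j k.castSucc 0))) := fun k j =>
    imp_congr_right fun hj => by rw [hx j (Or.inr hj)]
  simp only [FlowConstraints, hu, hx i (Or.inl rfl), h]

/-- The state of `i` as an affine function of its local decision variables. -/
def localState (i : V) : Copies P.E N i →ᵃ[ℝ] States N :=
  (P.trajectory i).comp (unselectₗ P.E N i).toAffineMap

theorem localState_select (i : V) (u : V → Inputs N) :
    P.localState i (select P.E i u) = P.trajectory i u :=
  P.trajectory_unselect_select (Or.inl rfl) u

/-- The local decision variables that, with the states they generate, lie in `𝒰_i`. -/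
def localInputs (i : V) : Set (Copies P.E N i) :=
  {w | P.FlowConstraints i (unselect w) fun j => P.trajectory j (unselect w)}

theorem mem_localSet_iff {i : V} {v : States N × Copies P.E N i} :
    v ∈ P.localSet i ↔ v.2 ∈ P.localInputs i ∧ v.1 = P.localState i v.2 := by
  constructor
  · rintro ⟨z, hz, hev, hfl⟩
    have hz' : ∀ j, j = i ∨ P.E.Adj i j → z j = P.trajectory j (unselect v.2) := fun j hj =>
      (P.evolves_iff _ _ _).1 (hev j hj)
    exact ⟨(P.flowConstraints_congr rfl hz').1 hfl, by rw [← hz, hz' i (Or.inl rfl)]; rfl⟩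
  · rintro ⟨h1, h2⟩
    exact ⟨fun j => P.trajectory j (unselect v.2), h2.symm,
      fun j _ => (P.evolves_iff _ _ _).2 rfl, h1⟩

theorem select_mem_localInputs {i : V} {u : V → Inputs N} :
    select P.E i u ∈ P.localInputs i ↔ P.FlowConstraints i u fun j => P.trajectory j u :=
  P.flowConstraints_congr (unselect_select (self_mem_hood _ _) u)
    fun _ hj => P.trajectory_unselect_select hj u

theorem isPolyhedron_localInputs (i : V) : IsPolyhedron (P.localInputs i) := by
  -- The constraints are affine in the inputs of the whole network, with the states eliminated.
  have h : IsPolyhedron {u | P.FlowConstraints i u fun j => P.trajectory j u} := by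
    let U : Fin N → Fin 2 → (V → Inputs N) →ᵃ[ℝ] ℝ := fun k c =>
      (LinearMap.proj (φ := fun _ : Fin 2 => ℝ) c ∘ₗ
        LinearMap.proj (φ := fun _ : Fin N => Fin 2 → ℝ) k ∘ₗ
        LinearMap.proj (φ := fun _ : V => Inputs N) i).toAffineMap
    let X : V → Fin N → Fin 2 → (V → Inputs N) →ᵃ[ℝ] ℝ := fun j k c =>
      (LinearMap.proj (φ := fun _ : Fin 2 => ℝ) c ∘ₗ
        LinearMap.proj (φ := fun _ : Fin (N + 1) => Fin 2 → ℝ) k.castSucc).toAffineMap.comp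
        (P.trajectory j)
    let cst : ℝ → (V → Inputs N) →ᵃ[ℝ] ℝ := fun r => AffineMap.const ℝ _ r
    have := IsPolyhedron.iInter fun k : Fin N =>
      ((IsPolyhedron.setOf_le (U k 1) (P.Vmax • X i k 0)).inter
        (IsPolyhedron.setOf_le (U k 1) (cst (P.φmax i)))).inter
      ((IsPolyhedron.iInter fun j : {j // P.E.Adj i j} =>
        (IsPolyhedron.setOf_le ((1 - P.β i k) • U k 1 + U k 0) (cst (P.φmax j))).inter
          (IsPolyhedron.setOf_le ((1 - P.β i k) • U k 1 + U k 0)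
            (P.ω • (cst (P.ρmax j) - X j k 0)))).inter
      ((IsPolyhedron.setOf_le (U k 0) (X i k 1)).inter
        (IsPolyhedron.setOf_le (U k 0) (cst P.Cmax))))
    convert this using 1
    ext u
    simp only [FlowConstraints, Set.mem_ofPred_eq, Set.mem_iInter, Set.mem_inter_iff, le_min_iff,
      Subtype.forall]
    refine forall_congr' fun k => ?_
    simp [U, X, cst, mul_comm]
  exact h.preimage (unselectₗ P.E N i)

/-- The share `H_i û_i` of agent `i` in the capacity constraint. -/
def usage (i : V) : Copies P.E N i →ₗ[ℝ] (Fin N → ℝ) where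
  toFun w k := P.h i ⬝ᵥ own w k
  map_add' _ _ := by
    funext k
    exact dotProduct_add _ _ _
  map_smul' r w := by
    funext k
    exact dotProduct_smul r (P.h i) (own w k)

theorem gap_apply (p : Fin N → ℝ) {i : V} (w : Copies P.E N i) (y : Fin N → ℝ) (k : Fin N) :
    P.gap p w y k = P.usage i w k - P.δ / Fintype.card V - p k + y k := rfl

/-- Excess over the capacity at step `k`, as an affine function of all decision variables. -/
def excess (k : Fin N) : ((i : V) → Copies P.E N i) →ᵃ[ℝ] ℝ :=
  (∑ i, LinearMap.proj (φ := fun _ : Fin N => ℝ) k ∘ₗ P.usage i ∘ₗ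
      LinearMap.proj (φ := fun i => Copies P.E N i) i).toAffineMap
    - AffineMap.const ℝ _ P.δ

theorem excess_apply (k : Fin N) (w : (i : V) → Copies P.E N i) :
    P.excess k w = ∑ i, P.usage i (w i) k - P.δ := by
  simp [excess]

/-- Decision variables of all agents that satisfy the local constraints. -/
def localProduct : Set ((i : V) → Copies P.E N i) := {w | ∀ i, w i ∈ P.localInputs i}

/-- Decision variables of all agents that satisfy the local constraints and the capacity
constraint, but need not agree with each other. -/
def admissible : Set ((i : V) → Copies P.E N i) :=
  {w | w ∈ P.localProduct ∧ ∀ k, P.excess k w ≤ 0}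

theorem isPolyhedron_localProduct : IsPolyhedron P.localProduct := by
  have := IsPolyhedron.iInter fun i =>
    (P.isPolyhedron_localInputs i).preimage (LinearMap.proj (φ := fun i => Copies P.E N i) i)
  convert this using 1
  ext w
  simp [localProduct]

theorem isPolyhedron_admissible : IsPolyhedron P.admissible := by
  have := P.isPolyhedron_localProduct.inter
    (IsPolyhedron.iInter fun k => IsPolyhedron.setOf_nonpos (P.excess k))
  convert this using 1
  ext w
  simp [admissible]

/-- The total cost as a function of the decision variables alone. -/
def netCost (w : (i : V) → Copies P.E N i) : ℝ := ∑ i, P.J i (P.localState i (w i), w i)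

theorem convexOn_localCost (hJ : ∀ i, ConvexOn ℝ Set.univ (P.J i)) (i : V) :
    ConvexOn ℝ Set.univ fun w : Copies P.E N i => P.J i (P.localState i w, w) :=
  (hJ i).comp_affineMap ((P.localState i).prod (AffineMap.id ℝ _))

theorem convexOn_netCost (hJ : ∀ i, ConvexOn ℝ Set.univ (P.J i)) :
    ConvexOn ℝ Set.univ P.netCost := by
  have h : P.netCost = ∑ i, fun w : (i : V) → Copies P.E N i =>
      P.J i (P.localState i (w i), w i) := by
    funext w
    simp [netCost]
  rw [h]
  refine Finset.sum_induction _ (ConvexOn ℝ Set.univ) (fun _ _ => ConvexOn.add)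
    (convexOn_const 0 convex_univ) fun i _ => ?_
  exact (P.convexOn_localCost hJ i).comp_linearMap
    (LinearMap.proj (φ := fun i => Copies P.E N i) i)

theorem feasible_iff {u : V → Inputs N} {x : V → States N} :
    P.Feasible u x ↔ selectAll P.E N u ∈ P.admissible ∧ ∀ i, x i = P.trajectory i u := by
  have hcap : ∀ k, P.excess k (selectAll P.E N u) ≤ 0 ↔ ∑ i, P.h i ⬝ᵥ u i k ≤ P.δ := fun k => by
    rw [excess_apply, sub_nonpos]
    rfl
  simp only [Feasible, evolves_iff, admissible, localProduct, Set.mem_ofPred_eq, hcap]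
  constructor
  · rintro ⟨hx, hfl, hc⟩
    obtain rfl : x = fun i => P.trajectory i u := funext hx
    exact ⟨⟨fun i => P.select_mem_localInputs.2 (hfl i), hc⟩, hx⟩
  · rintro ⟨⟨hfl, hc⟩, hx⟩
    obtain rfl : x = fun i => P.trajectory i u := funext hx
    exact ⟨hx, fun i => P.select_mem_localInputs.1 (hfl i), hc⟩

theorem totalCost_select {u : V → Inputs N} {x : V → States N}
    (hx : ∀ i, x i = P.trajectory i u) :
    P.totalCost x (fun i => select P.E i u) = P.netCost (selectAll P.E N u) := by
  refine Finset.sum_congr rfl fun i _ => ?_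
  rw [hx i, ← P.localState_select i u]
  rfl

theorem isOptimal_iff {u : V → Inputs N} {x : V → States N} :
    P.IsOptimal u x ↔ (selectAll P.E N u ∈ P.admissible ∧ ∀ i, x i = P.trajectory i u) ∧
      ∀ u', selectAll P.E N u' ∈ P.admissible →
        P.netCost (selectAll P.E N u) ≤ P.netCost (selectAll P.E N u') := by
  rw [IsOptimal, feasible_iff]
  refine and_congr_right fun h => ?_
  rw [P.totalCost_select h.2]
  constructor
  · intro hmin u' hu'
    have := hmin u' (fun i => P.trajectory i u') (P.feasible_iff.2 ⟨hu', fun _ => rfl⟩)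
    rwa [P.totalCost_select fun _ => rfl] at this
  · intro hmin u' x' h'
    obtain ⟨hu', hx'⟩ := P.feasible_iff.1 h'
    rw [P.totalCost_select hx']
    exact hmin u' hu'

/-! ### The inner iteration -/

theorem card_nbrs_pos [Nontrivial V] (hconn : (nbrGraph P.E).Connected) (i : V) :
    0 < (nbrs P.E i).card := by
  obtain ⟨j, hj⟩ := hconn.preconnected.exists_adj_of_nontrivial i
  exact Finset.card_pos.2 ⟨j, (mem_nbrs P.E).2 hj⟩

/-- Optimality of a local minimization, written with the local price that it yields. -/
theorem localCost_variational_inequality (hJ : ∀ i, ConvexOn ℝ Set.univ (P.J i)) {ρ₁ ρ₂ : ℝ}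
    (u : V → Inputs N) {i : V} (θ : Copies P.E N i) (p : Fin N → ℝ)
    {v : (States N × Copies P.E N i) × (Fin N → ℝ)} (hv : v.1 ∈ P.localSet i ∧ 0 ≤ v.2)
    (hmin : IsMinOn (P.localCost ρ₁ ρ₂ u θ p) {v | v.1 ∈ P.localSet i ∧ 0 ≤ v.2} v)
    {z : Copies P.E N i} (hz : z ∈ P.localInputs i) {y : Fin N → ℝ} (hy : 0 ≤ y) :
    0 ≤ P.J i (P.localState i z, z) - P.J i v.1
      + (∑ k, ((1 / (2 * (nbrs P.E i).card * ρ₂)) • P.gap p v.1.2 v.2) k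
          * ((P.usage i z k + y k) - (P.usage i v.1.2 k + v.2 k))
        + ρ₁ * copiesInner i (v.1.2 - select P.E i u + (1 / ρ₁) • θ) (z - v.1.2)) := by
  obtain ⟨⟨x', w'⟩, y'⟩ := v
  obtain ⟨hw', hx'⟩ := P.mem_localSet_iff.1 hv.1
  dsimp only at hw' hx' hv ⊢
  subst hx'
  set κ : ℝ := 1 / (4 * (nbrs P.E i).card * ρ₂) with hκ
  have hκ2 : 1 / (2 * (nbrs P.E i).card * ρ₂) = 2 * κ := by
    rw [hκ]
    ring
  refine variational_inequality (K := P.localInputs i ×ˢ {y : Fin N → ℝ | 0 ≤ y})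
    (F := fun a => P.J i (P.localState i a.1, a.1))
    (q := fun a => κ * ∑ k, P.gap p a.1 a.2 k ^ 2
      + ρ₁ / 2 * sqNorm (a.1 - select P.E i u + (1 / ρ₁) • θ))
    (C := κ * ∑ k, ((P.usage i z k + y k) - (P.usage i w' k + y' k)) ^ 2
      + ρ₁ / 2 * copiesInner i (z - w') (z - w'))
    (v := (w', y')) (z := (z, y)) ?_ ⟨hw', hv.2⟩ ⟨hz, hy⟩ ?_ ?_
  · exact ((P.convexOn_localCost hJ i).comp_linearMap (LinearMap.fst ℝ _ (Fin N → ℝ))).subset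
      (fun _ _ => trivial) ((P.isPolyhedron_localInputs i).convex.prod (convex_Ici 0))
  · intro a ha
    have := hmin (show ((P.localState i a.1, a.1), a.2) ∈ _ from
      ⟨P.mem_localSet_iff.2 ⟨ha.1, rfl⟩, ha.2⟩)
    simp only [Set.mem_ofPred_eq, localCost] at this
    linarith
  · intro t
    have hgap : ∀ k, P.gap p (w' + t • (z - w')) (y' + t • (y - y')) k = P.gap p w' y' k
        + t * ((P.usage i z k + y k) - (P.usage i w' k + y' k)) := fun k => by
      simp only [gap_apply, map_add, map_smul, map_sub, Pi.add_apply, Pi.smul_apply, Pi.sub_apply,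
        smul_eq_mul]
      ring
    have hsq : ∑ k, P.gap p (w' + t • (z - w')) (y' + t • (y - y')) k ^ 2 =
        ∑ k, P.gap p w' y' k ^ 2
        + t * (2 * ∑ k, P.gap p w' y' k * ((P.usage i z k + y k) - (P.usage i w' k + y' k)))
        + t ^ 2 * ∑ k, ((P.usage i z k + y k) - (P.usage i w' k + y' k)) ^ 2 := by
      simp only [hgap, Finset.mul_sum, ← Finset.sum_add_distrib]
      exact Finset.sum_congr rfl fun k _ => by ring
    have hnorm : sqNorm (w' + t • (z - w') - select P.E i u + (1 / ρ₁) • θ) =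
        sqNorm (w' - select P.E i u + (1 / ρ₁) • θ)
        + t * (2 * copiesInner i (w' - select P.E i u + (1 / ρ₁) • θ) (z - w'))
        + t ^ 2 * copiesInner i (z - w') (z - w') := by
      have : w' + t • (z - w') - select P.E i u + (1 / ρ₁) • θ =
          (w' - select P.E i u + (1 / ρ₁) • θ) + t • (z - w') := by abel
      rw [this]
      generalize w' - select P.E i u + (1 / ρ₁) • θ = c
      simp only [sqNorm_eq, map_add, map_smul, LinearMap.add_apply, LinearMap.smul_apply,
        smul_eq_mul, copiesInner_comm (z - w') c]
      ring
    have hsum : ∑ k, ((2 * κ) • P.gap p w' y') k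
          * ((P.usage i z k + y k) - (P.usage i w' k + y' k)) =
        2 * κ * ∑ k, P.gap p w' y' k * ((P.usage i z k + y k) - (P.usage i w' k + y' k)) := by
      rw [Finset.mul_sum]
      exact Finset.sum_congr rfl fun k _ => by simp only [Pi.smul_apply, smul_eq_mul, mul_assoc]
    simp only [Prod.fst_add, Prod.snd_add, Prod.smul_fst, Prod.smul_snd, Prod.fst_sub,
      Prod.snd_sub]
    rw [hκ2, hsum, hsq, hnorm]
    apply le_of_eq
    ring

theorem proximal_variational_inequality (hJ : ∀ i, ConvexOn ℝ Set.univ (P.J i)) {ρ₁ : ℝ}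
    {c ws : (i : V) → Copies P.E N i} (hws : ws ∈ P.admissible)
    (hmin : ∀ z ∈ P.admissible, P.netCost ws + ρ₁ / 2 * netInner (ws - c) (ws - c) ≤
      P.netCost z + ρ₁ / 2 * netInner (z - c) (z - c))
    {z : (i : V) → Copies P.E N i} (hz : z ∈ P.admissible) :
    0 ≤ P.netCost z - P.netCost ws + ρ₁ * netInner (ws - c) (z - ws) := by
  refine variational_inequality (q := fun z => ρ₁ / 2 * netInner (z - c) (z - c))
    ((P.convexOn_netCost hJ).subset (fun _ _ => trivial)
    P.isPolyhedron_admissible.convex) hws hz hmin (C := ρ₁ / 2 * netInner (z - ws) (z - ws))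
    fun t => ?_
  have : ws + t • (z - ws) - c = (ws - c) + t • (z - ws) := by abel
  rw [this]
  generalize ws - c = d
  simp only [map_add, map_smul, LinearMap.add_apply, LinearMap.smul_apply, smul_eq_mul,
    netInner_comm (z - ws) d]
  apply le_of_eq
  ring

/-- Optimal prices of the capacity constraint in the problem that an inner iteration solves. -/
theorem exists_price (hJ : ∀ i, ConvexOn ℝ Set.univ (P.J i)) {ρ₁ : ℝ}
    {c ws : (i : V) → Copies P.E N i} (hws : ws ∈ P.admissible)
    (hmin : ∀ z ∈ P.admissible, P.netCost ws + ρ₁ / 2 * netInner (ws - c) (ws - c) ≤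
      P.netCost z + ρ₁ / 2 * netInner (z - c) (z - c)) :
    ∃ μ : Fin N → ℝ, (∀ k, 0 ≤ μ k) ∧ (∀ k, μ k * P.excess k ws = 0) ∧
      ∀ z ∈ P.localProduct, 0 ≤ P.netCost z - P.netCost ws
        + ρ₁ * netInner (ws - c) (z - ws) + ∑ k, μ k * P.excess k z := by
  -- `ws` also minimizes the cost with the proximal term linearized at `ws`.
  obtain ⟨μ, hμ, h⟩ := exists_multipliers
    (f := fun z => P.netCost z + (ρ₁ • netInner (ws - c)) z)
    ((P.convexOn_netCost hJ).add ((ρ₁ • netInner (ws - c)).convexOn convex_univ))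
    P.isPolyhedron_localProduct P.excess hws.1 hws.2 (fun z hz hez => by
      have := P.proximal_variational_inequality hJ hws hmin ⟨hz, hez⟩
      simp only [map_sub, LinearMap.smul_apply, smul_eq_mul] at this ⊢
      linarith)
  have hnp : ∀ k ∈ Finset.univ, μ k * P.excess k ws ≤ 0 := fun k _ =>
    mul_nonpos_of_nonneg_of_nonpos (hμ k) (hws.2 k)
  refine ⟨μ, hμ, fun k => ?_, fun z hz => ?_⟩
  · have h1 := h ws hws.1
    exact (Finset.sum_eq_zero_iff_of_nonpos hnp).1
      (le_antisymm (Finset.sum_nonpos hnp) (by linarith)) k (Finset.mem_univ k)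
  · have := h z hz
    simp only [map_sub, LinearMap.smul_apply, smul_eq_mul] at this ⊢
    linarith

theorem alpha_antisymm {ρ₁ ρ₂ : ℝ} {u : V → Inputs N} {θ : (i : V) → Copies P.E N i}
    {x : ℕ → V → States N} {w : ℕ → (i : V) → Copies P.E N i} {y lam : ℕ → V → Fin N → ℝ}
    {α : ℕ → V → V → Fin N → ℝ} (hrun : P.IsInnerRun ρ₁ ρ₂ u θ x w y lam α) (l : ℕ) :
    ∀ i j, (nbrGraph P.E).Adj i j → α l i j = -α l j i := by
  induction l with
  | zero => exact hrun.init
  | succ l ih =>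
    intro i j hij
    rw [hrun.α_step l i j hij, hrun.α_step l j i hij.symm, ih i j hij, neg_add, ← smul_neg,
      neg_sub]

/-- Dual-consensus ADMM converges in the decision variables to the minimizer `ws` over the
admissible set. -/
theorem inner_tendsto [Nontrivial V] (hconn : (nbrGraph P.E).Connected)
    (hJ : ∀ i, ConvexOn ℝ Set.univ (P.J i)) {ρ₁ ρ₂ : ℝ} (hρ₁ : 0 < ρ₁) (hρ₂ : 0 < ρ₂)
    {u : V → Inputs N} {θ : (i : V) → Copies P.E N i} {x : ℕ → V → States N}
    {w : ℕ → (i : V) → Copies P.E N i} {y lam : ℕ → V → Fin N → ℝ}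
    {α : ℕ → V → V → Fin N → ℝ} (hrun : P.IsInnerRun ρ₁ ρ₂ u θ x w y lam α)
    {ws : (i : V) → Copies P.E N i} (hws : ws ∈ P.admissible)
    (hmin : ∀ z ∈ P.admissible,
      P.netCost ws + ρ₁ / 2 * netInner (ws - (selectAll P.E N u - (1 / ρ₁) • θ))
        (ws - (selectAll P.E N u - (1 / ρ₁) • θ)) ≤
      P.netCost z + ρ₁ / 2 * netInner (z - (selectAll P.E N u - (1 / ρ₁) • θ))
        (z - (selectAll P.E N u - (1 / ρ₁) • θ))) :
    Tendsto w atTop (𝓝 ws) := by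
  set c := selectAll P.E N u - (1 / ρ₁) • θ with hc
  obtain ⟨μ, hμ, hcompl, hsaddle⟩ := P.exists_price hJ hws hmin
  have hM : (Fintype.card V : ℝ) ≠ 0 := Nat.cast_ne_zero.2 Fintype.card_ne_zero
  -- The slack of the capacity constraint, shared equally, gives the optimal `y`.
  let ys : Fin N → ℝ := fun k => -P.excess k ws / Fintype.card V
  have hys : 0 ≤ ys := fun k => div_nonneg (neg_nonneg.2 (hws.2 k)) (Nat.cast_nonneg _)
  have hμys : ∀ k, μ k * ys k = 0 := fun k => by
    rw [mul_div_assoc', mul_neg, hcompl k, neg_zero, zero_div]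
  have hflow : ∀ k, ∃ g : V → V → ℝ, (∀ i j, g i j = -g j i) ∧ ∀ i, ∑ j ∈ nbrs P.E i, g i j =
      (P.usage i (ws i) k - P.δ / Fintype.card V + ys k) / 2 := fun k => by
    refine exists_flow hconn (fun i j => mem_nbrs P.E) ?_
    rw [← Finset.sum_div, Finset.sum_add_distrib, Finset.sum_sub_distrib]
    simp only [Finset.sum_const, Finset.card_univ, nsmul_eq_mul, ys, excess_apply]
    field_simp
    ring
  choose g hg hdiv using hflow
  have hnb : ∀ i j, j ∈ nbrs P.E i ↔ i ∈ nbrs P.E j := fun i j => by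
    rw [mem_nbrs, mem_nbrs, SimpleGraph.adj_comm]
  let Φ : ℕ → ℝ := fun l => ∑ k, dualLyapunov (nbrs P.E) ρ₂
    (fun i j => α l i j k - g k i j) (fun i => lam l i k - μ k)
  have hΦ0 : ∀ l, 0 ≤ Φ l := fun l => Finset.sum_nonneg fun k _ => dualLyapunov_nonneg _ hρ₂ _ _
  have hdesc : ∀ l, ρ₁ * netInner (w (l + 1) - ws) (w (l + 1) - ws) ≤ Φ l - Φ (l + 1) := by
    intro l
    have hmem : ∀ i, w (l + 1) i ∈ P.localInputs i ∧ x (l + 1) i = P.localState i (w (l + 1) i) :=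
      fun i => P.mem_localSet_iff.1 (hrun.mem l i).1
    -- Optimality of the local minimizers, tested at `(ws, ys)`.
    have hvi : 0 ≤ P.netCost ws - P.netCost (w (l + 1))
        + (∑ i, ∑ k, lam (l + 1) i k * ((P.usage i (ws i) k + ys k)
            - (P.usage i (w (l + 1) i) k + y (l + 1) i k))
          + ρ₁ * netInner (w (l + 1) - c) (ws - w (l + 1))) := by
      have h := Finset.sum_nonneg fun i (_ : i ∈ Finset.univ) =>
        P.localCost_variational_inequality hJ u (θ i) (P.price ρ₂ (lam l) (α l) i)
          (hrun.mem l i) (hrun.min l i) (hws.1 i) hys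
      have hc' : ∀ i, w (l + 1) i - select P.E i u + (1 / ρ₁) • θ i = (w (l + 1) - c) i :=
        fun i => by
          rw [hc, Pi.sub_apply, Pi.sub_apply, sub_sub_eq_add_sub, add_sub_right_comm]
          rfl
      simp only [← hrun.lam_step, hc', (hmem _).2, Finset.sum_add_distrib, Finset.sum_sub_distrib,
        ← Finset.mul_sum] at h
      simpa only [netInner_apply, netCost, mul_sub, Finset.sum_sub_distrib, Pi.sub_apply] using h
    have hs := hsaddle (w (l + 1)) fun i => (hmem i).1
    -- At the optimal prices the slacks `y` count nonnegatively and `ys` does not count.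
    have hexc : ∑ k, μ k * P.excess k (w (l + 1)) ≤ ∑ i, ∑ k, μ k *
        ((P.usage i (w (l + 1) i) k + y (l + 1) i k) - (P.usage i (ws i) k + ys k)) := by
      rw [Finset.sum_comm]
      refine Finset.sum_le_sum fun k _ => ?_
      rw [← Finset.mul_sum]
      have h1 : ∑ i, ((P.usage i (w (l + 1) i) k + y (l + 1) i k)
          - (P.usage i (ws i) k + ys k)) =
          P.excess k (w (l + 1)) - P.excess k ws + ∑ i, y (l + 1) i k
            - Fintype.card V * ys k := by
        simp only [Finset.sum_sub_distrib, Finset.sum_add_distrib, excess_apply, Finset.sum_const,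
          Finset.card_univ, nsmul_eq_mul]
        ring
      have h2 : 0 ≤ μ k * ∑ i, y (l + 1) i k :=
        mul_nonneg (hμ k) (Finset.sum_nonneg fun i _ => (hrun.mem l i).2 k)
      have h3 := hcompl k
      have h4 : μ k * (Fintype.card V * ys k) = 0 := by
        rw [mul_left_comm, hμys, mul_zero]
      rw [h1]
      simp only [mul_sub, mul_add]
      linarith
    have hquad : netInner (w (l + 1) - c) (ws - w (l + 1)) + netInner (ws - c) (w (l + 1) - ws) =
        -netInner (w (l + 1) - ws) (w (l + 1) - ws) := by
      simp only [map_sub, LinearMap.sub_apply]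
      ring
    have hcomb : ρ₁ * netInner (w (l + 1) - ws) (w (l + 1) - ws) ≤
        ∑ i, ∑ k, (lam (l + 1) i k - μ k) * ((P.usage i (ws i) k + ys k)
          - (P.usage i (w (l + 1) i) k + y (l + 1) i k)) := by
      have h1 : ∑ i, ∑ k, (lam (l + 1) i k - μ k) * ((P.usage i (ws i) k + ys k)
          - (P.usage i (w (l + 1) i) k + y (l + 1) i k)) =
          ∑ i, ∑ k, lam (l + 1) i k * ((P.usage i (ws i) k + ys k)
            - (P.usage i (w (l + 1) i) k + y (l + 1) i k)) +
          ∑ i, ∑ k, μ k * ((P.usage i (w (l + 1) i) k + y (l + 1) i k)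
            - (P.usage i (ws i) k + ys k)) := by
        simp only [← Finset.sum_add_distrib]
        exact Finset.sum_congr rfl fun i _ => Finset.sum_congr rfl fun k _ => by ring
      rw [h1]
      have h2 := congrArg (ρ₁ * ·) hquad
      simp only [mul_add, mul_neg] at h2
      linarith
    refine hcomb.trans ?_
    rw [Finset.sum_comm, ← Finset.sum_sub_distrib]
    refine Finset.sum_le_sum fun k _ => ?_
    -- The price update turns the mismatch of the agents into edge terms.
    have hedge : ∀ i, (P.usage i (ws i) k + ys k)
        - (P.usage i (w (l + 1) i) k + y (l + 1) i k) =
        -∑ j ∈ nbrs P.E i, (2 * (α l i j k - g k i j) + ρ₂ * (2 * (lam (l + 1) i k - μ k)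
          - (lam l i k - μ k) - (lam l j k - μ k))) := fun i => by
      have hd : ((nbrs P.E i).card : ℝ) ≠ 0 :=
        Nat.cast_ne_zero.2 (P.card_nbrs_pos hconn i).ne'
      have h1 := congrFun (hrun.lam_step l i) k
      rw [Pi.smul_apply, smul_eq_mul, gap_apply, one_div, eq_inv_mul_iff_mul_eq₀
        (mul_ne_zero (mul_ne_zero two_ne_zero hd) hρ₂.ne')] at h1
      have h2 := hdiv k i
      have h3 : ∑ j ∈ nbrs P.E i, (2 * (α l i j k - g k i j) + ρ₂ * (2 * (lam (l + 1) i k - μ k)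
          - (lam l i k - μ k) - (lam l j k - μ k))) =
          P.price ρ₂ (lam l) (α l) i k - 2 * ∑ j ∈ nbrs P.E i, g k i j
            + 2 * (nbrs P.E i).card * ρ₂ * lam (l + 1) i k := by
        have h4 : 2 * ((nbrs P.E i).card : ℝ) * ρ₂ * lam (l + 1) i k =
            ∑ j ∈ nbrs P.E i, 2 * ρ₂ * lam (l + 1) i k := by
          rw [Finset.sum_const, nsmul_eq_mul]
          ring
        rw [h4, price]
        simp only [Finset.mul_sum, ← Finset.sum_add_distrib, ← Finset.sum_sub_distrib]
        exact Finset.sum_congr rfl fun j _ => by ring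
      rw [h3, h2]
      linarith
    have hlyap := dualLyapunov_sub_le hnb hρ₂ (a := fun i j => α l i j k - g k i j)
      (a' := fun i j => α (l + 1) i j k - g k i j) (m := fun i => lam l i k - μ k)
      (m' := fun i => lam (l + 1) i k - μ k)
      (fun i j hj => by
        have := congrFun (P.alpha_antisymm hrun l i j ((mem_nbrs P.E).1 hj)) k
        rw [Pi.neg_apply] at this
        linarith [hg k i j])
      (fun i j hj => by
        have := congrFun (hrun.α_step l i j ((mem_nbrs P.E).1 hj)) k
        rw [Pi.add_apply, Pi.smul_apply, Pi.sub_apply, smul_eq_mul] at this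
        rw [this]
        ring)
    simp only [hedge, mul_neg, Finset.sum_neg_distrib]
    linarith
  have hlim := tendsto_atTop_ciInf (f := Φ) (antitone_nat_of_succ_le fun l => by
      have h1 := hdesc l
      have h2 := mul_nonneg hρ₁.le
        ((sq_nonneg _).trans (norm_sq_le_netInner (w (l + 1) - ws)))
      linarith)
    ⟨0, by rintro _ ⟨l, rfl⟩; exact hΦ0 l⟩
  have hdiff := (hlim.sub ((tendsto_add_atTop_iff_nat 1).2 hlim)).const_mul (1 / ρ₁)
  rw [sub_self, mul_zero] at hdiff
  refine (tendsto_add_atTop_iff_nat 1).1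
    (tendsto_of_bilin_sub_tendsto_zero (B := netInner) norm_sq_le_netInner ?_)
  refine squeeze_zero (fun l => (sq_nonneg _).trans (norm_sq_le_netInner _)) (fun l => ?_) hdiff
  rw [one_div, le_inv_mul_iff₀ hρ₁]
  exact hdesc l

/-! ### The outer iteration -/

/-- An optimal solution of the centralized problem, in the decision variables, with multipliers
of the consensus constraint `w = (E_i u)_i`. -/
theorem exists_consensus_saddle (hJ : ∀ i, ConvexOn ℝ Set.univ (P.J i))
    (hopt : ∃ u x, P.IsOptimal u x) :
    ∃ ws ∈ P.admissible, ws ∈ LinearMap.range (selectAll P.E N) ∧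
      ∃ θs : (i : V) → Copies P.E N i,
        (∀ r ∈ LinearMap.range (selectAll P.E N), netInner θs r = 0) ∧
        ∀ z ∈ P.admissible, P.netCost ws ≤ P.netCost z + netInner θs z := by
  obtain ⟨u, x, hux⟩ := hopt
  obtain ⟨⟨hadm, -⟩, hmin⟩ := P.isOptimal_iff.1 hux
  -- The disagreement between a copy and the original, one linear form for each copied coordinate.
  let D : (Σ i : V, ↥(hood P.E i) × Fin N × Fin 2) →
      ((i : V) → Copies P.E N i) →ₗ[ℝ] ℝ := fun t =>
    { toFun := fun w => w t.1 t.2.1 t.2.2.1 t.2.2.2 - own (w t.2.1) t.2.2.1 t.2.2.2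
      map_add' := fun w w' => by simp only [Pi.add_apply, own]; ring
      map_smul' := fun r w => by
        simp only [Pi.smul_apply, own, smul_eq_mul, RingHom.id_apply]; ring }
  have hD : ∀ t v, D t (selectAll P.E N v) = 0 := fun t v => sub_self _
  have hrange : ∀ w, (∀ t, D t w = 0) → ∃ v, w = selectAll P.E N v := fun w hw =>
    ⟨fun j => own (w j), funext fun i => funext fun j => funext fun k => funext fun c =>
      sub_eq_zero.1 (hw ⟨i, j, k, c⟩)⟩
  obtain ⟨μ, -, h⟩ := exists_multipliers (P.convexOn_netCost hJ) P.isPolyhedron_admissible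
    (Sum.elim (fun t => (D t).toAffineMap) fun t => (-D t).toAffineMap) hadm
    (by rintro (t | t) <;> simp [hD])
    (fun z hz hDz => by
      obtain ⟨v, rfl⟩ := hrange z fun t =>
        le_antisymm (by simpa using hDz (Sum.inl t)) (by simpa using hDz (Sum.inr t))
      exact hmin v hz)
  let L : ((i : V) → Copies P.E N i) →ₗ[ℝ] ℝ :=
    ∑ t, (μ (Sum.inl t) - μ (Sum.inr t)) • D t
  have hL : ∀ z, ∑ t, μ t * (Sum.elim (fun t => (D t).toAffineMap)
      (fun t => (-D t).toAffineMap) t : ((i : V) → Copies P.E N i) →ᵃ[ℝ] ℝ) z = L z := fun z => by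
    simp only [Fintype.sum_sum_type, Sum.elim_inl, Sum.elim_inr, L, LinearMap.sum_apply,
      LinearMap.smul_apply, smul_eq_mul, ← Finset.sum_add_distrib, LinearMap.coe_toAffineMap,
      LinearMap.neg_apply]
    exact Finset.sum_congr rfl fun t _ => by ring
  -- The inner product is nondegenerate, so the multiplier functional is represented by a vector.
  have hinj : Function.Injective (netInner (E := P.E) (N := N)) := by
    refine (injective_iff_map_eq_zero _).2 fun w hw => norm_eq_zero.1 ?_
    have := norm_sq_le_netInner w
    rw [hw, LinearMap.zero_apply] at this
    exact pow_eq_zero_iff two_ne_zero |>.1 (le_antisymm this (sq_nonneg _))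
  obtain ⟨θs, hθs⟩ := (LinearMap.injective_iff_surjective_of_finrank_eq_finrank
    (Subspace.dual_finrank_eq (K := ℝ)).symm).1 hinj L
  refine ⟨_, hadm, ⟨u, rfl⟩, θs, ?_, fun z hz => ?_⟩
  · rintro _ ⟨v, rfl⟩
    rw [hθs]
    simp [L, hD]
  · have := h z hz
    rwa [hL, ← hθs] at this

theorem continuous_localState (i : V) : Continuous (P.localState i) :=
  (P.localState i).continuous_of_finiteDimensional

variable {P}

/-- The value returned by an inner iteration is the solution of the penalized problem over the
admissible set, and the inner iterates converge to it. -/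
theorem Run.inner_limit [Nontrivial V] (hconn : (nbrGraph P.E).Connected)
    (hJ : ∀ i, ConvexOn ℝ Set.univ (P.J i)) (hne : P.admissible.Nonempty)
    {ρ₁ ρ₂ : ℝ} (hρ₁ : 0 < ρ₁) (hρ₂ : 0 < ρ₂) (R : P.Run ρ₁ ρ₂) (n : ℕ) :
    R.w (n + 1) ∈ P.admissible ∧
    (∀ z ∈ P.admissible, 0 ≤ P.netCost z - P.netCost (R.w (n + 1)) +
      netInner (R.θ n + ρ₁ • (R.w (n + 1) - selectAll P.E N (R.u n))) (z - R.w (n + 1))) ∧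
    (∀ i, Tendsto (fun l => R.win n l i) atTop (𝓝 (R.w (n + 1) i))) ∧
    (∀ i, Tendsto (fun l => R.xin n l i) atTop (𝓝 (R.x (n + 1) i))) ∧
    ∀ i, R.x (n + 1) i = P.localState i (R.w (n + 1) i) := by
  obtain ⟨ws, hws, hmin⟩ := exists_proximal_point (B := netInner) norm_sq_le_netInner
    (P.convexOn_netCost hJ) P.isPolyhedron_admissible.isClosed hne hρ₁
    (selectAll P.E N (R.u n) - (1 / ρ₁) • R.θ n)
  have hw := tendsto_pi_nhds.1 (P.inner_tendsto hconn hJ hρ₁ hρ₂ (R.inner n) hws hmin)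
  have hx : ∀ i, Tendsto (fun l => R.xin n l i) atTop (𝓝 (P.localState i (ws i))) := fun i => by
    refine (tendsto_add_atTop_iff_nat 1).1 ?_
    refine ((((P.continuous_localState i).tendsto (ws i)).comp (hw i)).comp
      (tendsto_add_atTop_nat 1)).congr fun l => ?_
    exact (P.mem_localSet_iff.1 ((R.inner n).mem l i).1).2.symm
  have hweq : R.w (n + 1) = ws := funext fun i => by rw [R.w_step n i, (hw i).limUnder_eq]
  have hxeq : ∀ i, R.x (n + 1) i = P.localState i (ws i) := fun i => by
    rw [R.x_step n i, (hx i).limUnder_eq]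
  rw [hweq]
  refine ⟨hws, fun z hz => ?_, hw, fun i => by rw [hxeq]; exact hx i, hxeq⟩
  have h := P.proximal_variational_inequality hJ hws hmin hz
  have hcoef : R.θ n + ρ₁ • (ws - selectAll P.E N (R.u n)) =
      ρ₁ • (ws - (selectAll P.E N (R.u n) - (1 / ρ₁) • R.θ n)) := by
    rw [smul_sub, smul_sub, smul_sub, smul_smul, mul_one_div_cancel hρ₁.ne', one_smul]
    abel
  rwa [hcoef, map_smul, LinearMap.smul_apply, smul_eq_mul]

/-- After the first update, the multipliers are orthogonal to the consensus subspace: this is the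
normal equation of the averaging step for the net variable. -/
theorem Run.netInner_multiplier {ρ₁ ρ₂ : ℝ} (hρ₁ : 0 < ρ₁) (R : P.Run ρ₁ ρ₂) (n : ℕ)
    (v : V → Inputs N) : netInner (R.θ (n + 1)) (selectAll P.E N v) = 0 := by
  have h : ∀ j, ∑ i, unselect (R.θ (n + 1) i) j = 0 := fun j => by
    have hcard : ((hood P.E j).card : ℝ) ≠ 0 :=
      Nat.cast_ne_zero.2 (Finset.card_pos.2 ⟨j, self_mem_hood _ _⟩).ne'
    have h1 : ∀ i, unselect (R.θ (n + 1) i) j = ρ₁ •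
        (unselect (R.w (n + 1) i + (1 / ρ₁) • R.θ n i) j -
          unselect (select P.E i (R.u (n + 1))) j) := fun i => by
      have : R.θ (n + 1) i = ρ₁ • ((R.w (n + 1) i + (1 / ρ₁) • R.θ n i) -
          select P.E i (R.u (n + 1))) := by
        rw [R.θ_step, smul_sub, smul_sub, smul_add, smul_smul, mul_one_div_cancel hρ₁.ne',
          one_smul]
        abel
      rw [this]
      change unselectₗ P.E N i _ j = ρ₁ • (unselectₗ P.E N i _ j - unselectₗ P.E N i _ j)
      rw [map_smul, map_sub]
      rfl
    have h2 := R.u_step n j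
    rw [one_div, eq_inv_smul_iff₀ hcard] at h2
    simp only [h1]
    rw [← Finset.smul_sum, Finset.sum_sub_distrib, sum_unselect_select, h2, sub_self, smul_zero]
  rw [netInner_selectAll]
  simp only [h, Pi.zero_apply, zero_mul, Finset.sum_const_zero]

end Problem

end Traffic

end

theorem theorem1 {V : Type*} [Fintype V] [Nontrivial V] {N : ℕ} (P : Traffic.Problem V N)
    (hconn : (Traffic.nbrGraph P.E).Connected)
    (hJ : ∀ i, ConvexOn ℝ Set.univ (P.J i))
    (hopt : ∃ u x, P.IsOptimal u x)
    (ρ₁ ρ₂ : ℝ) (hρ₁ : 0 < ρ₁) (hρ₂ : 0 < ρ₂) (R : P.Run ρ₁ ρ₂) :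
    (∀ n i, Tendsto (fun l => R.win n l i) atTop (𝓝 (R.w (n + 1) i)) ∧
      Tendsto (fun l => R.xin n l i) atTop (𝓝 (R.x (n + 1) i))) ∧
    (∃ u x, P.IsOptimal u x ∧
      ∀ i, Tendsto (fun n => R.w n i) atTop (𝓝 (Traffic.select P.E i u)) ∧
        Tendsto (fun n => R.x n i) atTop (𝓝 (x i))) ∧
    (∀ u x, P.IsOptimal u x →
      Tendsto (fun n => |∑ i, (P.J i (R.x n i, R.w n i) -
        P.J i (x i, Traffic.select P.E i u))|) atTop (𝓝 0)) := by
  have hsaddle := P.exists_consensus_saddle hJ hopt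
  have hne : P.admissible.Nonempty := hsaddle.imp fun _ h => h.1
  have hin := R.inner_limit hconn hJ hne hρ₁ hρ₂
  obtain ⟨wl, hwlC, ⟨ul, rfl⟩, hmin, hlim⟩ := Traffic.consensus_admm_tendsto
    (B := Traffic.netInner) (R := LinearMap.range (Traffic.selectAll P.E N))
    (w := R.w) (v := fun n => Traffic.selectAll P.E N (R.u n)) (θ := R.θ)
    Traffic.netInner_comm Traffic.norm_sq_le_netInner
    (Traffic.continuous_of_convexOn (P.convexOn_netCost hJ)) P.isPolyhedron_admissible.isClosed
    hρ₁ (fun n => (hin n).1) (fun n => (hin n).2.1) (fun n => ⟨_, rfl⟩)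
    (fun n => funext fun i => R.θ_step n i)
    (fun n r hr => by
      obtain ⟨v, rfl⟩ := hr
      exact R.netInner_multiplier hρ₁ n v) hsaddle
  have hw : ∀ i, Tendsto (fun n => R.w n i) atTop (𝓝 (Traffic.select P.E i ul)) :=
    tendsto_pi_nhds.1 hlim
  have hx : ∀ i, Tendsto (fun n => R.x n i) atTop (𝓝 (P.trajectory i ul)) := fun i => by
    rw [← P.localState_select i ul]
    refine (tendsto_add_atTop_iff_nat 1).1 ?_
    exact ((((P.continuous_localState i).tendsto _).comp (hw i)).comp
      (tendsto_add_atTop_nat 1)).congr fun n => ((hin n).2.2.2.2 i).symm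
  have hul : P.IsOptimal ul fun i => P.trajectory i ul :=
    P.isOptimal_iff.2 ⟨⟨hwlC, fun _ => rfl⟩, fun u' hu' => hmin _ hu' ⟨u', rfl⟩⟩
  refine ⟨fun n i => ⟨(hin n).2.2.1 i, (hin n).2.2.2.1 i⟩, ⟨ul, _, hul, fun i => ⟨hw i, hx i⟩⟩,
    fun u x hux => ?_⟩
  -- All optimal solutions have the same cost, and the cost is continuous.
  have hcost : ∑ i, (P.J i (P.trajectory i ul, Traffic.select P.E i ul)
      - P.J i (x i, Traffic.select P.E i u)) = 0 := by
    rw [Finset.sum_sub_distrib, sub_eq_zero]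
    exact le_antisymm (hul.2 u x hux.1) (hux.2 ul _ hul.1)
  have h := tendsto_finsetSum Finset.univ fun i (_ : i ∈ Finset.univ) =>
    (((Traffic.continuous_of_convexOn (hJ i)).tendsto _).comp
      ((hx i).prodMk_nhds (hw i))).sub_const (P.J i (x i, Traffic.select P.E i u))
  rw [hcost] at h
  simpa using h.abs
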